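/- Let $(a;q)_0=1$ and $(a;q)_n=\prod_{i=1}^{n}(1-aq^{i-1})$ for $n\ge 1$, and define the integers $v_0(n)$, $n\ge 0$, by the formal power series identity $$\sum_{n=0}^\infty v_0(n)q^n=\sum_{n=0}^\infty \frac{q^{n^2}(-q;q^2)_n}{(q;q^2)_n}=\frac{V_0(q)+1}{2},$$ where $V_0(q)=-1+2\sum_{n=0}^\infty \frac{q^{n^2}(-q;q^2)_n}{(q;q^2)_n}$ is the eighth order mock theta function of Gordon and McIntosh. Then for every integer $n\ge 0$, $$v_0\bigl(3^2(96n+68)\bigr)\equiv 0 \pmod{27},\qquad v_0\bigl(3^3(96n+44)\bigr)\equiv 0 \pmod{27},\qquad v_0\bigl(3^3(96n+76)\bigr)\equiv 0 \pmod{27}.$$ -/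

import Mathlib

/-- The finite `q`-Pochhammer symbol `(a; q)_n = ∏_{i=1}^{n} (1 - a q^{i-1})`, for formal power
series `a` and `q` with integer coefficients. -/
noncomputable def qPochhammer (a q : PowerSeries ℤ) (n : ℕ) : PowerSeries ℤ :=
  ∏ i ∈ Finset.range n, (1 - a * q ^ i)

/-- The `k`-th summand `q^{k^2} (-q; q^2)_k / (q; q^2)_k` of the series `(V_0(q) + 1) / 2`.
Here `q` is the formal variable; the denominator has constant coefficient `1`
(`constantCoeff_qPochhammer_X`), so `PowerSeries.invOfUnit _ 1` is its inverse
(`v0Summand_mul`). -/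
noncomputable def v0Summand (k : ℕ) : PowerSeries ℤ :=
  PowerSeries.X ^ (k ^ 2) * qPochhammer (-PowerSeries.X) (PowerSeries.X ^ 2) k *
    PowerSeries.invOfUnit (qPochhammer PowerSeries.X (PowerSeries.X ^ 2) k) 1

/-- `v_0(n)`: the coefficient of `q^n` in `∑_{k ≥ 0} q^{k^2} (-q; q^2)_k / (q; q^2)_k`.
The `k`-th summand is divisible by `q^{k^2}`, so only the summands with `k ≤ n` contribute to
this coefficient; `hasSum_v0` shows that the generating function of `v0` is the infinite sum. -/
noncomputable def v0 (n : ℕ) : ℤ :=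
  ∑ k ∈ Finset.range (n + 1), PowerSeries.coeff n (v0Summand k)

theorem constantCoeff_qPochhammer_X (k : ℕ) :
    PowerSeries.constantCoeff (qPochhammer PowerSeries.X (PowerSeries.X ^ 2) k) = 1 := by
  simp [qPochhammer, map_prod]

theorem v0Summand_mul (k : ℕ) :
    v0Summand k * qPochhammer PowerSeries.X (PowerSeries.X ^ 2) k =
      PowerSeries.X ^ (k ^ 2) * qPochhammer (-PowerSeries.X) (PowerSeries.X ^ 2) k := by
  have h := PowerSeries.invOfUnit_mul (qPochhammer PowerSeries.X (PowerSeries.X ^ 2) k) 1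
    (by simpa using constantCoeff_qPochhammer_X k)
  rw [v0Summand, mul_assoc, h, mul_one]

theorem coeff_v0Summand_of_lt {n k : ℕ} (h : n < k) :
    PowerSeries.coeff n (v0Summand k) = 0 := by
  rw [v0Summand, mul_assoc, PowerSeries.coeff_X_pow_mul', if_neg]
  nlinarith

open scoped PowerSeries.WithPiTopology in
/-- The identity `∑ v_0(n) q^n = ∑ q^{k^2} (-q; q^2)_k / (q; q^2)_k`, as a convergent sum of
formal power series (coefficientwise, `ℤ` being discrete). -/
theorem hasSum_v0 : HasSum v0Summand (PowerSeries.mk v0) := by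
  rw [PowerSeries.WithPiTopology.hasSum_iff_hasSum_coeff]
  intro n
  rw [PowerSeries.coeff_mk]
  apply hasSum_sum_of_ne_finset_zero
  intro k hk
  apply coeff_v0Summand_of_lt
  simpa using hk

/-! Write `φ(q)`, `φ(-q)`, `ψ(q)` for the theta functions, `g = ∏ (1 + q^n)`, and `U_m` for the
operator keeping the exponents divisible by `m` and replacing `q^m` by `q`.

The mock theta series is the member `k = 0` of a family in which `q^{2k}` plays the role of a free
parameter. A telescoping argument links `k` to `k + 1` (`mockSeries_recurrence`). Adding the image
under `q ↦ -q` and subtracting 1 makes the recurrence homogeneous. Letting `k → ∞` then gives a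
genuine quotient of theta functions: twice the even part of `∑ v₀(n) q^n`, minus 1, is `φ(q²)² /
φ(-q⁴)` (`bilateral_zero_mul_ex_phiNeg`).

From there only theta functions occur. Dissections by powers of 2 yield `2 ∑ v₀(4n) q^n - 1 = φ(q)²
/ φ(-q)` and then `2 ∑ v₀(4(8n+1)) q^n = 6ψ + 1024 q g²⁷ φ(-q)` (`oddSeries_eq`).

Modulo 27, `g²⁷ ≡ g(q³)⁹`, so applying `U_3` twice to `g²⁷ φ(-q)` gives `φ(-q) U_3(g⁹)`, which is
congruent to `ψ + 9 q ψ(q⁹)` (`phiNeg_mul_sect_congr`). Hence `2 v₀(36(8j+1))` is congruent to a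
combination of the `j`-th coefficients of `ψ` and `q ψ(q⁹)` (`v0_congr`). Triangular numbers are `0
mod 3` or `1 mod 9`, so both coefficients vanish for the other residues of `j`; the three
progressions are `j = 3n+2`, `9n+4`, `9n+7`. -/

section

open PowerSeries Filter Topology
open scoped PowerSeries.WithPiTopology

namespace EighthOrderMock

/-! ### Convergence of formal power series -/

theorem hasSum_of_X_pow_dvd {ι : Type*} {f : ι → ℤ⟦X⟧} (s : ℕ → Finset ι)
    (h : ∀ d, ∀ i ∉ s d, X ^ (d + 1) ∣ f i) : HasSum f (∑' i, f i) := by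
  refine Summable.hasSum ?_
  refine ⟨PowerSeries.mk fun d => ∑ i ∈ s d, coeff d (f i), ?_⟩
  rw [WithPiTopology.hasSum_iff_hasSum_coeff]
  intro d
  rw [coeff_mk]
  exact hasSum_sum_of_ne_finset_zero fun i hi => X_pow_dvd_iff.1 (h d i hi) d (Nat.lt_succ_self d)

theorem coeff_eq_sum_of_hasSum {ι : Type*} {f : ι → ℤ⟦X⟧} {a : ℤ⟦X⟧} (hf : HasSum f a) {d : ℕ}
    (s : Finset ι) (h : ∀ i ∉ s, X ^ (d + 1) ∣ f i) : coeff d a = ∑ i ∈ s, coeff d (f i) := by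
  have h1 := (WithPiTopology.hasSum_iff_hasSum_coeff ℤ).1 hf d
  exact h1.unique (hasSum_sum_of_ne_finset_zero fun i hi =>
    X_pow_dvd_iff.1 (h i hi) d (Nat.lt_succ_self d))

theorem tendsto_of_X_pow_dvd {u : ℕ → ℤ⟦X⟧} {a : ℤ⟦X⟧}
    (h : ∀ d, ∃ N, ∀ n ≥ N, X ^ (d + 1) ∣ u n - a) : Tendsto u atTop (𝓝 a) := by
  rw [WithPiTopology.tendsto_iff_coeff_tendsto]
  intro d
  obtain ⟨N, hN⟩ := h d
  refine tendsto_nhds_of_eventually_eq ?_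
  filter_upwards [eventually_ge_atTop N] with n hn
  have := X_pow_dvd_iff.1 (hN n hn) d (Nat.lt_succ_self d)
  rwa [map_sub, sub_eq_zero] at this

/-- A sum over `ℤ` may be computed over the residue classes modulo `m`. -/
theorem hasSum_int_of_residues {M : Type*} [AddCommMonoid M] [TopologicalSpace M] [ContinuousAdd M]
    {f : ℤ → M} {m : ℕ} (hm : 0 < m) {a : ℕ → M}
    (h : ∀ r < m, HasSum (fun k : ℤ => f (m * k + r)) (a r)) :
    HasSum f (∑ r ∈ Finset.range m, a r) := by
  classical
  have hm' : (m : ℤ) ≠ 0 := by exact_mod_cast hm.ne'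
  have key : f = fun n : ℤ => ∑ r ∈ Finset.range m, if n % m = r then f n else 0 := by
    funext n
    have h0 := Int.emod_nonneg n hm'
    have h1 := Int.emod_lt_of_pos n (by exact_mod_cast hm : (0 : ℤ) < m)
    rw [Finset.sum_eq_single (n % m).toNat]
    · rw [if_pos (by omega)]
    · intro r _ hr
      rw [if_neg (by omega)]
    · intro hr
      exact absurd (Finset.mem_range.2 (by omega)) hr
  rw [key]
  refine hasSum_sum fun r hr => ?_
  have hr' := Finset.mem_range.1 hr
  have inj : Function.Injective fun k : ℤ => (m : ℤ) * k + r := fun x y hxy => by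
    simpa [hm.ne'] using hxy
  refine (inj.hasSum_iff (f := fun n : ℤ => if n % m = r then f n else 0) ?_).1 ?_
  · intro n hn
    refine if_neg fun hr2 => hn ⟨n / m, ?_⟩
    have := Int.mul_ediv_add_emod n m
    simp only
    omega
  · convert h r hr' using 2 with k
    have : ((m : ℤ) * k + r) % m = r := by
      rw [Int.add_emod, Int.mul_emod_right, zero_add, Int.emod_emod]
      exact Int.emod_eq_of_lt (by omega) (by omega)
    simp [this]

/-! ### Ramanujan's theta function -/

/-- The triangular number `n (n + 1) / 2`, for `n ∈ ℤ`. -/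
def tri (n : ℤ) : ℕ := (n * (n + 1) / 2).toNat

theorem two_mul_tri (n : ℤ) : 2 * (tri n : ℤ) = n * (n + 1) := by
  have h0 : 0 ≤ n * (n + 1) := by
    rcases le_or_gt 0 n with h | h
    · positivity
    · nlinarith
  have h2 : (2 : ℤ) ∣ n * (n + 1) := (Int.even_mul_succ_self n).two_dvd
  rw [tri, Int.toNat_of_nonneg (by positivity)]
  omega

theorem tri_add_tri_neg (n : ℤ) : ((tri n + tri (-n) : ℕ) : ℤ) = n ^ 2 := by
  have h1 := two_mul_tri n
  have h2 := two_mul_tri (-n)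
  push_cast
  linarith

/-- The two exponents add up to `n²`. This bound gives convergence of the theta series for all `x`,
`y` divisible by `X`. -/
theorem natAbs_le_tri_add (n : ℤ) : n.natAbs ≤ tri n + tri (-n) := by
  zify
  have := tri_add_tri_neg n
  push_cast at this
  rw [this, ← sq_abs]
  nlinarith [abs_nonneg n, Int.le_self_sq |n|]

/-- The general term `x^{n (n + 1) / 2} y^{n (n - 1) / 2}` of the theta function. -/
def thetaTerm {R : Type*} [CommRing R] (x y : R) (n : ℤ) : R := x ^ tri n * y ^ tri (-n)

/-- Ramanujan's theta function `∑_{n ∈ ℤ} x^{n (n + 1) / 2} y^{n (n - 1) / 2}`. -/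
noncomputable def theta (x y : ℤ⟦X⟧) : ℤ⟦X⟧ := ∑' n : ℤ, thetaTerm x y n

theorem X_pow_dvd_thetaTerm {x y : ℤ⟦X⟧} (hx : X ∣ x) (hy : X ∣ y) (n : ℤ) :
    X ^ n.natAbs ∣ thetaTerm x y n :=
  (pow_dvd_pow _ (natAbs_le_tri_add n)).trans
    (by rw [pow_add]; exact mul_dvd_mul (pow_dvd_pow_of_dvd hx _) (pow_dvd_pow_of_dvd hy _))

theorem X_pow_dvd_thetaTerm_of_notMem {x y : ℤ⟦X⟧} (hx : X ∣ x) (hy : X ∣ y) (d : ℕ) (n : ℤ)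
    (hn : n ∉ Finset.Icc (-d : ℤ) d) : X ^ (d + 1) ∣ thetaTerm x y n := by
  refine (pow_dvd_pow _ ?_).trans (X_pow_dvd_thetaTerm hx hy n)
  rw [Finset.mem_Icc] at hn
  omega

theorem hasSum_theta {x y : ℤ⟦X⟧} (hx : X ∣ x) (hy : X ∣ y) :
    HasSum (thetaTerm x y) (theta x y) :=
  hasSum_of_X_pow_dvd (fun d => Finset.Icc (-d : ℤ) d)
    fun d n hn => X_pow_dvd_thetaTerm_of_notMem hx hy d n hn

/-! ### The Jacobi triple product -/

section TripleProduct

variable {R : Type*} [CommRing R]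

/-- The Gaussian binomial coefficient with parameter `Q`. -/
def gaussBinom (Q : R) : ℕ → ℕ → R
  | _, 0 => 1
  | 0, _ + 1 => 0
  | m + 1, j + 1 => gaussBinom Q m j + Q ^ (j + 1) * gaussBinom Q m (j + 1)

/-- The product `(1 - Q) ⋯ (1 - Q^n)`. -/
def qFactor (Q : R) (n : ℕ) : R := ∏ i ∈ Finset.range n, (1 - Q ^ (i + 1))

theorem gaussBinom_zero_right (Q : R) (m : ℕ) : gaussBinom Q m 0 = 1 := by
  cases m <;> simp [gaussBinom]

theorem gaussBinom_of_lt (Q : R) : ∀ {m j : ℕ}, m < j → gaussBinom Q m j = 0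
  | 0, j + 1, _ => by simp [gaussBinom]
  | m + 1, j + 1, h => by
    rw [gaussBinom, gaussBinom_of_lt Q (by omega : m < j), gaussBinom_of_lt Q (by omega)]
    simp

theorem gaussBinom_self (Q : R) : ∀ m : ℕ, gaussBinom Q m m = 1
  | 0 => by simp [gaussBinom]
  | m + 1 => by
    rw [gaussBinom, gaussBinom_self Q m, gaussBinom_of_lt Q (Nat.lt_succ_self m)]
    simp

/-- The factorial formula, free of division. The induction rests on `1 - Q^{i+j+2} = (1 - Q^{j+1}) +
Q^{j+1} (1 - Q^{i+1})`, one summand for each term of the Pascal rule. -/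
theorem gaussBinom_mul (Q : R) : ∀ i j : ℕ,
    gaussBinom Q (i + j) j * (qFactor Q i * qFactor Q j) = qFactor Q (i + j)
  | i, 0 => by simp [gaussBinom_zero_right, qFactor]
  | 0, j + 1 => by
    rw [zero_add, gaussBinom_self]
    simp [qFactor]
  | i + 1, j + 1 => by
    have h1 := gaussBinom_mul Q (i + 1) j
    have h2 := gaussBinom_mul Q i (j + 1)
    rw [show i + 1 + (j + 1) = (i + 1 + j) + 1 by ring, gaussBinom]
    rw [show i + (j + 1) = i + 1 + j by ring] at h2
    have e1 : qFactor Q (j + 1) = qFactor Q j * (1 - Q ^ (j + 1)) := Finset.prod_range_succ _ _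
    have e2 : qFactor Q (i + 1) = qFactor Q i * (1 - Q ^ (i + 1)) := Finset.prod_range_succ _ _
    have e3 : qFactor Q (i + 1 + j + 1) = qFactor Q (i + 1 + j) * (1 - Q ^ (i + 1 + j + 1)) :=
      Finset.prod_range_succ _ _
    rw [e3]
    linear_combination (1 - Q ^ (j + 1)) * h1 + Q ^ (j + 1) * (1 - Q ^ (i + 1)) * h2 +
      gaussBinom Q (i + 1 + j) j * qFactor Q (i + 1) * e1 +
      Q ^ (j + 1) * gaussBinom Q (i + 1 + j) (j + 1) * qFactor Q (j + 1) * e2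

/-- The Pascal rule moved onto a test function; it drives the induction steps of both the
`q`-binomial theorem and the finite triple product. -/
theorem sum_gaussBinom_succ (Q : R) (m : ℕ) (f : ℕ → R) :
    ∑ j ∈ Finset.range (m + 2), gaussBinom Q (m + 1) j * f j =
      ∑ j ∈ Finset.range (m + 1), gaussBinom Q m j * (f (j + 1) + Q ^ j * f j) := by
  rw [Finset.sum_range_succ']
  simp only [gaussBinom, add_mul, mul_add, Finset.sum_add_distrib, add_assoc]
  congr 1
  rw [Finset.sum_range_succ, gaussBinom_of_lt Q (Nat.lt_succ_self m), Finset.sum_range_succ' _ m]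
  simp [gaussBinom_zero_right, mul_comm, mul_left_comm]

/-- The `q`-binomial theorem. Splitting off the factor `i = 0` replaces `x` by `x Q` in the rest, so
`x` must vary in the induction. -/
theorem prod_one_add_mul_pow (Q : R) (l : ℕ) : ∀ x : R,
    ∏ i ∈ Finset.range l, (1 + x * Q ^ i) =
      ∑ j ∈ Finset.range (l + 1), gaussBinom Q l j * (x ^ j * Q ^ j.choose 2) := by
  induction l with
  | zero => intro x; simp [gaussBinom]
  | succ l ih =>
    intro x
    rw [sum_gaussBinom_succ, Finset.prod_range_succ']
    have : ∀ i ∈ Finset.range l, 1 + x * Q ^ (i + 1) = 1 + (x * Q) * Q ^ i := fun i _ => by ring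
    rw [Finset.prod_congr rfl this, ih, Finset.sum_mul]
    refine Finset.sum_congr rfl fun j _ => ?_
    rw [Nat.choose_succ_succ' j 1, Nat.choose_one_right]
    ring

theorem mul_thetaTerm_sub_one (x y : R) (j k : ℕ) :
    (x * y) ^ j * thetaTerm x y (j - k - 1) = y * (x * y) ^ k * thetaTerm x y (j - k) := by
  have h1 : j + tri ((j : ℤ) - k - 1) = k + tri ((j : ℤ) - k) := by
    have a := two_mul_tri ((j : ℤ) - k - 1)
    have b := two_mul_tri ((j : ℤ) - k)
    zify
    linarith
  have h2 : j + tri (-((j : ℤ) - k - 1)) = 1 + k + tri (-((j : ℤ) - k)) := by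
    have a := two_mul_tri (-((j : ℤ) - k - 1))
    have b := two_mul_tri (-((j : ℤ) - k))
    zify
    linarith
  calc _ = x ^ (j + tri ((j : ℤ) - k - 1)) * y ^ (j + tri (-((j : ℤ) - k - 1))) := by
        rw [thetaTerm]; ring
    _ = _ := by rw [h1, h2, thetaTerm]; ring

/-- The finite form of the Jacobi triple product. -/
theorem prod_mul_prod_eq_sum_thetaTerm (x y : R) (l k : ℕ) :
    (∏ i ∈ Finset.range l, (1 + x * (x * y) ^ i)) * ∏ i ∈ Finset.range k, (1 + y * (x * y) ^ i) =
      ∑ j ∈ Finset.range (k + l + 1), gaussBinom (x * y) (k + l) j * thetaTerm x y (j - k) := by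
  induction k with
  | zero =>
    simp only [Finset.range_zero, Finset.prod_empty, mul_one, zero_add]
    rw [prod_one_add_mul_pow]
    refine Finset.sum_congr rfl fun j _ => ?_
    have h1 : tri ((j : ℤ) - (0 : ℕ)) = j + j.choose 2 := by
      have a := two_mul_tri ((j : ℤ) - (0 : ℕ))
      have b := Nat.triangle_succ j
      have c : (2 : ℤ) * (j + j.choose 2) = j * (j + 1) := by
        have : (j.choose 2 : ℚ) = j * (j - 1) / 2 := Nat.cast_choose_two ℚ j
        have : (2 : ℚ) * (j + j.choose 2) = j * (j + 1) := by rw [this]; ring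
        exact_mod_cast this
      push_cast at a
      zify
      linarith
    have h2 : tri (-((j : ℤ) - (0 : ℕ))) = j.choose 2 := by
      have a := two_mul_tri (-((j : ℤ) - (0 : ℕ)))
      have c : (2 : ℤ) * (j.choose 2) = j * (j - 1) := by
        have : (j.choose 2 : ℚ) = j * (j - 1) / 2 := Nat.cast_choose_two ℚ j
        have : (2 : ℚ) * (j.choose 2) = j * (j - 1) := by rw [this]; ring
        exact_mod_cast this
      push_cast at a
      zify
      linarith
    rw [thetaTerm, h1, h2]
    ring
  | succ k ih =>
    rw [Finset.prod_range_succ, ← mul_assoc, ih, show k + 1 + l = k + l + 1 by ring,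
      sum_gaussBinom_succ, Finset.sum_mul]
    refine Finset.sum_congr rfl fun j _ => ?_
    have h := mul_thetaTerm_sub_one x y j k
    rw [show ((j : ℤ) - ((k + 1 : ℕ) : ℤ)) = j - k - 1 by push_cast; ring,
      show (((j + 1 : ℕ) : ℤ) - ((k + 1 : ℕ) : ℤ)) = j - k by push_cast; ring, h]
    ring

end TripleProduct

theorem X_pow_dvd_qFactor_sub {Q : ℤ⟦X⟧} (hQ : X ∣ Q) {d i j : ℕ} (hi : d ≤ i) (hj : d ≤ j) :
    X ^ d ∣ qFactor Q i - qFactor Q j := by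
  have key : ∀ n, X ^ d ∣ qFactor Q (d + n) - qFactor Q d := by
    intro n
    induction n with
    | zero => simp
    | succ n ih =>
      have e : qFactor Q (d + (n + 1)) = qFactor Q (d + n) * (1 - Q ^ (d + n + 1)) :=
        Finset.prod_range_succ _ _
      have h2 : X ^ d ∣ Q ^ (d + n + 1) :=
        (pow_dvd_pow_of_dvd hQ d).trans (pow_dvd_pow _ (by omega))
      have := ih.sub (h2.mul_left (qFactor Q (d + n)))
      convert this using 1
      rw [e]; ring
  obtain ⟨a, rfl⟩ := Nat.exists_eq_add_of_le hi
  obtain ⟨b, rfl⟩ := Nat.exists_eq_add_of_le hj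
  convert (key a).sub (key b) using 1
  ring

theorem isUnit_of_constantCoeff {f : ℤ⟦X⟧} (h : constantCoeff f = 1) : IsUnit f := by
  rw [PowerSeries.isUnit_iff_constantCoeff, h]
  exact isUnit_one

theorem isUnit_qFactor {Q : ℤ⟦X⟧} (hQ : X ∣ Q) (n : ℕ) : IsUnit (qFactor Q n) := by
  refine isUnit_of_constantCoeff ?_
  have : constantCoeff Q = 0 := PowerSeries.X_dvd_iff.1 hQ
  simp [qFactor, map_prod, this]

/-- The **Jacobi triple product** identity. -/
theorem tendsto_tripleProduct {x y : ℤ⟦X⟧} (hx : X ∣ x) (hy : X ∣ y) :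
    Tendsto (fun N => (∏ i ∈ Finset.range N, (1 + x * (x * y) ^ i)) *
      (∏ i ∈ Finset.range N, (1 + y * (x * y) ^ i)) * qFactor (x * y) N) atTop
      (𝓝 (theta x y)) := by
  have hQ : X ∣ x * y := hx.mul_right y
  refine tendsto_of_X_pow_dvd fun d => ⟨2 * d + 2, fun N hN => ?_⟩
  simp only [prod_mul_prod_eq_sum_thetaTerm]
  -- If `j` and `2N - j` both exceed `d`, the normalised binomial is 1 modulo `X^{d+1}`; otherwise
  -- `|j - N| > d` because `N ≥ 2d + 2`, and the theta term itself is negligible.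
  have hterm : ∀ j ∈ Finset.range (N + N + 1), X ^ (d + 1) ∣
      (gaussBinom (x * y) (N + N) j * qFactor (x * y) N - 1) * thetaTerm x y (j - N) := by
    intro j hj
    rw [Finset.mem_range] at hj
    by_cases hjd : d + 1 ≤ j ∧ j + (d + 1) ≤ N + N
    · refine Dvd.dvd.mul_right ?_ _
      have h := gaussBinom_mul (x * y) (N + N - j) j
      rw [show N + N - j + j = N + N by omega] at h
      have h1 : X ^ (d + 1) ∣ qFactor (x * y) (N + N - j) - qFactor (x * y) N :=
        X_pow_dvd_qFactor_sub hQ (by omega) (by omega)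
      have h2 : X ^ (d + 1) ∣ qFactor (x * y) j - qFactor (x * y) (N + N) :=
        X_pow_dvd_qFactor_sub hQ (by omega) (by omega)
      -- Multiplying by a unit brings in `(Q; Q)_{2N}`, so that the division-free factorial formula
      -- applies.
      rw [← (isUnit_qFactor hQ (N + N)).dvd_mul_right]
      have h3 := (h2.mul_left (gaussBinom (x * y) (N + N) j * qFactor (x * y) (N + N - j))).neg_right
      have h4 := (h1.mul_left (gaussBinom (x * y) (N + N) j * qFactor (x * y) (N + N))).neg_right
      convert h3.add h4 using 1
      linear_combination h
    · refine Dvd.dvd.mul_left ?_ _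
      refine X_pow_dvd_thetaTerm_of_notMem hx hy d _ ?_
      rw [Finset.mem_Icc]
      omega
  rw [X_pow_dvd_iff]
  intro m hm
  have hsum : coeff m (theta x y) =
      ∑ j ∈ Finset.range (N + N + 1), coeff m (thetaTerm x y (j - N)) := by
    rw [coeff_eq_sum_of_hasSum (hasSum_theta hx hy) (Finset.Icc (-N : ℤ) N)]
    · refine Finset.sum_nbij' (fun n => (n + N).toNat) (fun j => (j : ℤ) - N) ?_ ?_ ?_ ?_ ?_
      · intro n hn; rw [Finset.mem_Icc] at hn; rw [Finset.mem_range]; omega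
      · intro j hj; rw [Finset.mem_range] at hj; rw [Finset.mem_Icc]; omega
      · intro n hn; rw [Finset.mem_Icc] at hn; omega
      · intro j hj; omega
      · intro n hn
        rw [Finset.mem_Icc] at hn
        rw [show (((n + N).toNat : ℕ) : ℤ) - N = n by omega]
    · intro n hn
      refine X_pow_dvd_thetaTerm_of_notMem hx hy m _ fun h => hn ?_
      rw [Finset.mem_Icc] at h ⊢
      omega
  rw [map_sub, hsum, Finset.sum_mul, map_sum, ← Finset.sum_sub_distrib]
  refine Finset.sum_eq_zero fun j hj => ?_
  have := X_pow_dvd_iff.1 (hterm j hj) m hm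
  rw [← map_sub, ← this]
  congr 1
  ring

/-! ### Infinite products -/

/-- The infinite product `∏_{i ≥ 0} (1 + ε X^{a i + b})`. -/
noncomputable def infProd (ε : ℤ) (a b : ℕ) : ℤ⟦X⟧ := ∏' i : ℕ, (1 + (ε : ℤ⟦X⟧) * X ^ (a * i + b))

theorem tendsto_infProd (ε : ℤ) {a : ℕ} (ha : 0 < a) (b : ℕ) :
    Tendsto (fun N => ∏ i ∈ Finset.range N, (1 + (ε : ℤ⟦X⟧) * X ^ (a * i + b))) atTop
      (𝓝 (infProd ε a b)) := by
  refine Multipliable.tendsto_prod_tprod_nat ?_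
  refine WithPiTopology.multipliable_one_add_of_tendsto_order_atTop_nhds_top ℤ ?_
  refine ENat.tendsto_nhds_top_iff_natCast_lt.mpr fun n => ?_
  filter_upwards [eventually_ge_atTop (n + 1)] with i hi
  have h : ((n + 1 : ℕ) : ℕ∞) ≤ ((ε : ℤ⟦X⟧) * X ^ (a * i + b)).order := by
    refine PowerSeries.nat_le_order _ _ fun m hm => ?_
    refine X_pow_dvd_iff.1 (Dvd.dvd.mul_left (pow_dvd_pow _ ?_) _) m hm
    nlinarith
  refine lt_of_lt_of_le ?_ h
  exact_mod_cast Nat.lt_succ_self n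

theorem prod_range_mul_eq {M : Type*} [CommMonoid M] (f : ℕ → M) (m N : ℕ) :
    ∏ i ∈ Finset.range (m * N), f i =
      ∏ r ∈ Finset.range m, ∏ i ∈ Finset.range N, f (m * i + r) := by
  induction N with
  | zero => simp
  | succ N ih =>
    simp only [Nat.mul_succ, Finset.prod_range_add, ih, Finset.prod_range_succ,
      Finset.prod_mul_distrib]

theorem infProd_eq_prod (ε : ℤ) {a m : ℕ} (ha : 0 < a) (hm : 0 < m) (b : ℕ) :
    infProd ε a b = ∏ r ∈ Finset.range m, infProd ε (m * a) (a * r + b) := by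
  have h1 : Tendsto (fun N => m * N) atTop atTop := tendsto_id.const_mul_atTop' hm
  have h2 := (tendsto_infProd ε ha b).comp h1
  refine tendsto_nhds_unique h2 ?_
  simp only [Function.comp_def, prod_range_mul_eq]
  refine tendsto_finsetProd _ fun r _ => ?_
  have := tendsto_infProd ε (Nat.mul_pos hm ha) (a * r + b)
  refine this.congr fun N => Finset.prod_congr rfl fun i _ => ?_
  rw [show m * a * i + (a * r + b) = a * (m * i + r) + b by ring]

theorem infProd_split_two (ε : ℤ) {a : ℕ} (ha : 0 < a) (b : ℕ) :
    infProd ε a b = infProd ε (2 * a) b * infProd ε (2 * a) (a + b) := by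
  rw [infProd_eq_prod ε (m := 2) ha (by norm_num), Finset.prod_range_succ, Finset.prod_range_one]
  simp

theorem infProd_split_three (ε : ℤ) {a : ℕ} (ha : 0 < a) (b : ℕ) :
    infProd ε a b =
      infProd ε (3 * a) b * infProd ε (3 * a) (a + b) * infProd ε (3 * a) (a * 2 + b) := by
  rw [infProd_eq_prod ε (m := 3) ha (by norm_num), Finset.prod_range_succ, Finset.prod_range_succ,
    Finset.prod_range_one]
  simp

theorem infProd_mul_infProd_neg {a : ℕ} (ha : 0 < a) (b : ℕ) :
    infProd 1 a b * infProd (-1) a b = infProd (-1) (2 * a) (2 * b) := by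
  refine tendsto_nhds_unique ((tendsto_infProd 1 ha b).mul (tendsto_infProd (-1) ha b)) ?_
  convert tendsto_infProd (-1) (show 0 < 2 * a by omega) (2 * b) using 2 with N
  rw [← Finset.prod_mul_distrib]
  refine Finset.prod_congr rfl fun i _ => ?_
  rw [show 2 * a * i + 2 * b = (a * i + b) + (a * i + b) by ring, pow_add]
  push_cast
  ring

theorem constantCoeff_infProd (ε : ℤ) {a b : ℕ} (ha : 0 < a) (hb : 0 < b) :
    constantCoeff (infProd ε a b) = 1 := by
  have h := ((WithPiTopology.continuous_constantCoeff ℤ).tendsto _).comp (tendsto_infProd ε ha b)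
  refine tendsto_nhds_unique h ?_
  convert tendsto_const_nhds (x := (1 : ℤ)) with N
  simp [map_prod, hb.ne']

theorem infProd_ne_zero (ε : ℤ) {a b : ℕ} (ha : 0 < a) (hb : 0 < b) : infProd ε a b ≠ 0 := by
  intro h
  have := constantCoeff_infProd ε ha hb
  simp [h] at this

/-- The triple product with base `x y = X^{a+b}`, the signs cancelling since `ε² = 1`. -/
theorem theta_eq_infProd {ε : ℤ} (hε : ε ^ 2 = 1) {a b : ℕ} (ha : 0 < a) (hb : 0 < b) :
    theta ((ε : ℤ⟦X⟧) * X ^ a) ((ε : ℤ⟦X⟧) * X ^ b) =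
      infProd ε (a + b) a * infProd ε (a + b) b * infProd (-1) (a + b) (a + b) := by
  have hx : ∀ {c : ℕ}, 0 < c → (X : ℤ⟦X⟧) ∣ (ε : ℤ⟦X⟧) * X ^ c := fun hc =>
    (dvd_pow_self X hc.ne').mul_left _
  have hxy : ((ε : ℤ⟦X⟧) * X ^ a) * ((ε : ℤ⟦X⟧) * X ^ b) = X ^ (a + b) := by
    have : (ε : ℤ⟦X⟧) ^ 2 = 1 := by exact_mod_cast congrArg (Int.cast : ℤ → ℤ⟦X⟧) hε
    rw [pow_add]
    linear_combination (X ^ a * X ^ b) * this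
  refine tendsto_nhds_unique (tendsto_tripleProduct (hx ha) (hx hb)) ?_
  have hab : 0 < a + b := by omega
  convert ((tendsto_infProd ε hab a).mul (tendsto_infProd ε hab b)).mul
    (tendsto_infProd (-1) hab (a + b)) using 2 with N
  rw [hxy]
  congr 1
  · congr 1
    all_goals
      refine Finset.prod_congr rfl fun i _ => ?_
      rw [← pow_mul]
      ring
  · refine Finset.prod_congr rfl fun i _ => ?_
    rw [← pow_mul, show (a + b) * (i + 1) = (a + b) * i + (a + b) by ring]
    push_cast
    ring

/-! ### The theta functions `φ(q)`, `φ(-q)`, `ψ(q)`, `f(q, q²)`, `f(-q⁵, -q)` -/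

/-- `φ(q) = ∑ q^{n²}`. -/
noncomputable def phi : ℤ⟦X⟧ := theta X X

/-- `φ(-q) = ∑ (-1)^n q^{n²}`. -/
noncomputable def phiNeg : ℤ⟦X⟧ := theta (-X) (-X)

/-- `ψ(q) = ∑ q^{n (2n - 1)}`. -/
noncomputable def psi : ℤ⟦X⟧ := theta X (X ^ 3)

/-- `f(q, q²)`, the generating function of the generalized pentagonal numbers. -/
noncomputable def pent : ℤ⟦X⟧ := theta X (X ^ 2)

/-- `f(-q⁵, -q) = ∑ (-1)^n q^{3n² + 2n}`. -/
noncomputable def octo : ℤ⟦X⟧ := theta (-X ^ 5) (-X)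

/-- The product `∏_{n ≥ 1} (1 + q^n)`. -/
noncomputable def gg : ℤ⟦X⟧ := infProd 1 1 1

/-- Substitution of `q^k` for `q`. -/
noncomputable abbrev ex (k : ℕ) [NeZero k] : ℤ⟦X⟧ →ₐ[ℤ] ℤ⟦X⟧ := PowerSeries.expand k (NeZero.ne k)

theorem ex_ex (k l : ℕ) [NeZero k] [NeZero l] (f : ℤ⟦X⟧) : ex k (ex l f) = ex (k * l) f :=
  (PowerSeries.expand_mul k (NeZero.ne k) l (NeZero.ne l) f).symm

theorem continuous_ex (k : ℕ) [NeZero k] : Continuous (ex k) := by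
  refine continuous_iff_continuousAt.2 fun f => ?_
  rw [ContinuousAt, WithPiTopology.tendsto_iff_coeff_tendsto]
  intro d
  simp only [ex, PowerSeries.coeff_expand]
  split_ifs
  · exact (WithPiTopology.continuous_coeff ℤ _).tendsto f
  · exact tendsto_const_nhds

theorem thetaTerm_map {R S : Type*} [CommRing R] [CommRing S] (h : R →+* S) (x y : R) (n : ℤ) :
    h (thetaTerm x y n) = thetaTerm (h x) (h y) n := by
  simp [thetaTerm]

theorem X_dvd_ex (k : ℕ) [NeZero k] {x : ℤ⟦X⟧} (hx : X ∣ x) : X ∣ ex k x := by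
  rw [PowerSeries.X_dvd_iff] at hx ⊢
  rw [PowerSeries.constantCoeff_expand, hx]

theorem ex_theta (k : ℕ) [NeZero k] {x y : ℤ⟦X⟧} (hx : X ∣ x) (hy : X ∣ y) :
    ex k (theta x y) = theta (ex k x) (ex k y) := by
  have h := (hasSum_theta hx hy).map (ex k) (continuous_ex k)
  refine h.unique ?_
  convert hasSum_theta (X_dvd_ex k hx) (X_dvd_ex k hy) using 1
  funext n
  exact thetaTerm_map (ex k : ℤ⟦X⟧ →+* ℤ⟦X⟧) x y n

theorem X_dvd_neg_X_pow {n : ℕ} (hn : n ≠ 0) : (X : ℤ⟦X⟧) ∣ -X ^ n :=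
  (dvd_pow_self X hn).neg_right

theorem ex_phi (k : ℕ) [NeZero k] :
    ex k phi = infProd 1 (k + k) k * infProd 1 (k + k) k * infProd (-1) (k + k) (k + k) := by
  have hk : 0 < k := NeZero.pos k
  rw [phi, ex_theta k dvd_rfl dvd_rfl, ← theta_eq_infProd (by norm_num) hk hk]
  simp

theorem ex_phiNeg (k : ℕ) [NeZero k] :
    ex k phiNeg =
      infProd (-1) (k + k) k * infProd (-1) (k + k) k * infProd (-1) (k + k) (k + k) := by
  have hk : 0 < k := NeZero.pos k
  rw [phiNeg, ex_theta k dvd_rfl.neg_right dvd_rfl.neg_right,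
    ← theta_eq_infProd (by norm_num) hk hk]
  simp

theorem ex_psi (k : ℕ) [NeZero k] :
    ex k psi =
      infProd 1 (k + k * 3) k * infProd 1 (k + k * 3) (k * 3) *
        infProd (-1) (k + k * 3) (k + k * 3) := by
  have hk : 0 < k := NeZero.pos k
  rw [psi, ex_theta k dvd_rfl (dvd_pow_self X three_ne_zero),
    ← theta_eq_infProd (by norm_num) hk (by omega)]
  simp [pow_mul]

theorem ex_one_apply (f : ℤ⟦X⟧) : ex 1 f = f := PowerSeries.expand_one_apply f

theorem phi_eq : phi = infProd 1 2 1 ^ 2 * infProd (-1) 2 2 := by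
  rw [← ex_one_apply phi, ex_phi]; ring

theorem phiNeg_eq : phiNeg = infProd (-1) 2 1 ^ 2 * infProd (-1) 2 2 := by
  rw [← ex_one_apply phiNeg, ex_phiNeg]; ring

theorem psi_eq : psi = infProd 1 2 1 * infProd (-1) 4 4 := by
  rw [← ex_one_apply psi, ex_psi, infProd_split_two 1 two_pos 1]
  norm_num

theorem pent_eq : pent = infProd 1 3 1 * infProd 1 3 2 * infProd (-1) 3 3 := by
  rw [pent]
  simpa using theta_eq_infProd (ε := 1) (by norm_num) (a := 1) (b := 2) (by norm_num) (by norm_num)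

theorem octo_eq : octo = infProd (-1) 6 5 * infProd (-1) 6 1 * infProd (-1) 6 6 := by
  rw [octo]
  simpa using theta_eq_infProd (ε := -1) (by norm_num) (a := 5) (b := 1) (by norm_num) (by norm_num)

/-! ### Multiplicative relations between theta functions, read off from their products -/

theorem gg_mul_infProd : gg * infProd (-1) 2 1 = 1 := by
  have h1 : gg * infProd (-1) 1 1 = infProd (-1) 2 2 := infProd_mul_infProd_neg one_pos 1
  have h2 : infProd (-1) 1 1 = infProd (-1) 2 1 * infProd (-1) 2 2 :=
    infProd_split_two (-1) one_pos 1
  refine mul_right_cancel₀ (infProd_ne_zero (-1) (a := 2) (b := 2) two_pos two_pos) ?_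
  linear_combination h1 - gg * h2

theorem psi_eq_gg_mul : psi = gg ^ 3 * phiNeg := by
  have h1 : infProd 1 2 1 * infProd (-1) 2 1 = infProd (-1) 4 2 :=
    infProd_mul_infProd_neg two_pos 1
  have h2 : infProd (-1) 2 2 = infProd (-1) 4 2 * infProd (-1) 4 4 :=
    infProd_split_two (-1) two_pos 2
  have h3 := gg_mul_infProd
  have h4 : gg ^ 3 * phiNeg = gg * infProd (-1) 2 2 := by
    rw [phiNeg_eq]
    linear_combination gg * infProd (-1) 2 2 * (gg * infProd (-1) 2 1 + 1) * h3
  rw [psi_eq, h4, h2, ← h1]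
  linear_combination (-infProd 1 2 1 * infProd (-1) 4 4) * h3

theorem pent_eq_gg_mul : pent = gg * ex 3 phiNeg := by
  have h1 : infProd (-1) 3 3 = infProd (-1) 6 3 * infProd (-1) 6 6 :=
    infProd_split_two (-1) three_pos 3
  have h2 : infProd 1 3 3 * infProd (-1) 3 3 = infProd (-1) 6 6 :=
    infProd_mul_infProd_neg three_pos 3
  have h3 : infProd 1 3 3 * infProd (-1) 6 3 = 1 := by
    refine mul_right_cancel₀ (infProd_ne_zero (-1) (a := 6) (b := 6) (by norm_num) (by norm_num)) ?_
    rw [one_mul, mul_assoc, ← h1, h2]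
  have h4 : gg = infProd 1 3 1 * infProd 1 3 2 * infProd 1 3 3 :=
    infProd_split_three 1 one_pos 1
  rw [ex_phiNeg, pent_eq, h4, h1]
  linear_combination (-infProd 1 3 1 * infProd 1 3 2 * infProd (-1) 6 3 * infProd (-1) 6 6) * h3

theorem gg_mul_octo : gg * octo = ex 3 psi := by
  have h1 : infProd (-1) 2 1 = infProd (-1) 6 1 * infProd (-1) 6 3 * infProd (-1) 6 5 :=
    infProd_split_three (-1) two_pos 1
  have h2 : infProd 1 6 3 = infProd 1 12 3 * infProd 1 12 9 :=
    infProd_split_two 1 (by norm_num) 3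
  have h3 : infProd 1 6 3 * infProd (-1) 6 3 = infProd (-1) 12 6 :=
    infProd_mul_infProd_neg (by norm_num) 3
  have h4 : infProd (-1) 6 6 = infProd (-1) 12 6 * infProd (-1) 12 12 :=
    infProd_split_two (-1) (by norm_num) 6
  have h5 := gg_mul_infProd
  have h6 : octo = infProd (-1) 2 1 * ex 3 psi := by
    rw [ex_psi, octo_eq, h1, h4, ← h3, h2]
    ring
  rw [h6, ← mul_assoc, h5, one_mul]

theorem phi_mul_phiNeg : phi * phiNeg = ex 2 phiNeg ^ 2 := by
  have h1 : infProd 1 2 1 * infProd (-1) 2 1 = infProd (-1) 4 2 :=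
    infProd_mul_infProd_neg two_pos 1
  have h2 : infProd (-1) 2 2 = infProd (-1) 4 2 * infProd (-1) 4 4 :=
    infProd_split_two (-1) two_pos 2
  rw [ex_phiNeg, phi_eq, phiNeg_eq, h2, ← h1]
  ring

theorem psi_sq : psi ^ 2 = phi * ex 2 psi := by
  have h1 : infProd (-1) 2 2 = infProd (-1) 4 2 * infProd (-1) 4 4 :=
    infProd_split_two (-1) two_pos 2
  have h2 : infProd 1 4 2 * infProd (-1) 4 2 = infProd (-1) 8 4 :=
    infProd_mul_infProd_neg (by norm_num) 2
  have h3 : infProd (-1) 4 4 = infProd (-1) 8 4 * infProd (-1) 8 8 :=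
    infProd_split_two (-1) (by norm_num) 4
  have h4 : infProd 1 4 2 = infProd 1 8 2 * infProd 1 8 6 :=
    infProd_split_two 1 (by norm_num) 2
  rw [ex_psi, psi_eq, phi_eq, h1]
  linear_combination infProd 1 2 1 ^ 2 * infProd (-1) 4 4 * h3 -
    infProd 1 2 1 ^ 2 * infProd (-1) 4 4 * infProd (-1) 8 8 * h2 +
    infProd 1 2 1 ^ 2 * infProd (-1) 4 4 * infProd (-1) 8 8 * infProd (-1) 4 2 * h4

theorem infProd_mul_ex_phiNeg :
    infProd 1 4 2 * ex 4 phiNeg = infProd (-1) 4 2 * ex 2 phi := by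
  have h2 : infProd 1 4 2 * infProd (-1) 4 2 = infProd (-1) 8 4 :=
    infProd_mul_infProd_neg (by norm_num) 2
  have h3 : infProd (-1) 4 4 = infProd (-1) 8 4 * infProd (-1) 8 8 :=
    infProd_split_two (-1) (by norm_num) 4
  rw [ex_phiNeg, ex_phi]
  linear_combination (-infProd 1 4 2 * infProd (-1) 8 4 * infProd (-1) 8 8) * h2 -
    infProd 1 4 2 ^ 2 * infProd (-1) 4 2 * h3

/-! ### Dissections of the theta functions -/

theorem thetaTerm_X_pow (a b : ℕ) (n : ℤ) :
    thetaTerm (X ^ a : ℤ⟦X⟧) (X ^ b) n = X ^ (a * tri n + b * tri (-n)) := by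
  rw [thetaTerm, ← pow_mul, ← pow_mul, pow_add]

theorem thetaTerm_neg_X_pow (a b : ℕ) (n : ℤ) :
    thetaTerm (-X ^ a : ℤ⟦X⟧) (-X ^ b) n =
      ((n.negOnePow : ℤ) : ℤ⟦X⟧) * X ^ (a * tri n + b * tri (-n)) := by
  have h : ((n.negOnePow : ℤ) : ℤ⟦X⟧) = (-1) ^ (tri n + tri (-n)) := by
    have h1 : n.negOnePow = ((tri n + tri (-n) : ℕ) : ℤ).negOnePow := by
      rw [Int.negOnePow_eq_iff, tri_add_tri_neg, show n - n ^ 2 = -((n - 1) * (n - 1 + 1)) by ring,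
        even_neg]
      exact Int.even_mul_succ_self (n - 1)
    rw [h1, Int.coe_negOnePow_natCast]
    push_cast
    rfl
  rw [h, thetaTerm, neg_pow, neg_pow (X ^ b), ← pow_mul, ← pow_mul, pow_add, pow_add]
  ring

theorem X_dvd_X_pow {n : ℕ} (hn : n ≠ 0) : (X : ℤ⟦X⟧) ∣ X ^ n := dvd_pow_self X hn

theorem hasSum_theta_X_pow {a b : ℕ} (ha : a ≠ 0) (hb : b ≠ 0) :
    HasSum (fun n => (X : ℤ⟦X⟧) ^ (a * tri n + b * tri (-n))) (theta (X ^ a) (X ^ b)) := by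
  simpa only [← thetaTerm_X_pow] using hasSum_theta (X_dvd_X_pow ha) (X_dvd_X_pow hb)

theorem hasSum_theta_neg_X_pow {a b : ℕ} (ha : a ≠ 0) (hb : b ≠ 0) :
    HasSum (fun n : ℤ => ((n.negOnePow : ℤ) : ℤ⟦X⟧) * X ^ (a * tri n + b * tri (-n)))
      (theta (-X ^ a) (-X ^ b)) := by
  simpa only [← thetaTerm_neg_X_pow] using
    hasSum_theta (X_dvd_neg_X_pow ha) (X_dvd_neg_X_pow hb)

theorem hasSum_comp_neg {f : ℤ → ℤ⟦X⟧} {a : ℤ⟦X⟧} (h : HasSum f a) : HasSum (fun n => f (-n)) a :=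
  (Equiv.neg ℤ).hasSum_iff.2 h

theorem hasSum_comp_add_one {f : ℤ → ℤ⟦X⟧} {a : ℤ⟦X⟧} (h : HasSum f a) :
    HasSum (fun n => f (n + 1)) a :=
  (Equiv.addRight (1 : ℤ)).hasSum_iff.2 h

theorem hasSum_comp_neg_add_one {f : ℤ → ℤ⟦X⟧} {a : ℤ⟦X⟧} (h : HasSum f a) :
    HasSum (fun n => f (-(n + 1))) a :=
  hasSum_comp_add_one (hasSum_comp_neg h)

theorem hasSum_int_even_odd {f : ℤ → ℤ⟦X⟧} {a b : ℤ⟦X⟧} (ha : HasSum (fun k => f (2 * k)) a)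
    (hb : HasSum (fun k => f (2 * k + 1)) b) : HasSum f (a + b) := by
  have := hasSum_int_of_residues (f := f) (m := 2) (a := fun r => if r = 0 then a else b)
    two_pos fun r hr => by interval_cases r <;> simpa
  simpa [Finset.sum_range_succ] using this

theorem hasSum_int_mod_three {f : ℤ → ℤ⟦X⟧} {a b c : ℤ⟦X⟧} (ha : HasSum (fun k => f (3 * k)) a)
    (hb : HasSum (fun k => f (3 * k + 1)) b) (hc : HasSum (fun k => f (3 * k + 2)) c) :
    HasSum f (a + b + c) := by
  have := hasSum_int_of_residues (f := f) (m := 3)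
    (a := fun r => if r = 0 then a else if r = 1 then b else c)
    three_pos fun r hr => by interval_cases r <;> simpa
  simpa [Finset.sum_range_succ] using this

theorem hasSum_ex_theta_X_pow (k a b : ℕ) [NeZero k] (ha : a ≠ 0) (hb : b ≠ 0) :
    HasSum (fun n => (X : ℤ⟦X⟧) ^ (k * (a * tri n + b * tri (-n))))
      (ex k (theta (X ^ a) (X ^ b))) := by
  rw [ex_theta k (X_dvd_X_pow ha) (X_dvd_X_pow hb)]
  have hk := NeZero.ne k
  simpa [← pow_mul, mul_add, mul_assoc] using
    hasSum_theta_X_pow (mul_ne_zero hk ha) (mul_ne_zero hk hb)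

theorem hasSum_ex_theta_neg_X_pow (k a b : ℕ) [NeZero k] (ha : a ≠ 0) (hb : b ≠ 0) :
    HasSum (fun n : ℤ => ((n.negOnePow : ℤ) : ℤ⟦X⟧) * X ^ (k * (a * tri n + b * tri (-n))))
      (ex k (theta (-X ^ a) (-X ^ b))) := by
  rw [ex_theta k (X_dvd_neg_X_pow ha) (X_dvd_neg_X_pow hb)]
  have hk := NeZero.ne k
  simpa [← pow_mul, mul_add, mul_assoc] using
    hasSum_theta_neg_X_pow (mul_ne_zero hk ha) (mul_ne_zero hk hb)

theorem hasSum_ex_phi (k : ℕ) [NeZero k] :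
    HasSum (fun n => (X : ℤ⟦X⟧) ^ (k * (1 * tri n + 1 * tri (-n)))) (ex k phi) := by
  simpa [phi] using hasSum_ex_theta_X_pow k 1 1 one_ne_zero one_ne_zero

theorem hasSum_ex_psi (k : ℕ) [NeZero k] :
    HasSum (fun n => (X : ℤ⟦X⟧) ^ (k * (1 * tri n + 3 * tri (-n)))) (ex k psi) := by
  simpa [psi] using hasSum_ex_theta_X_pow k 1 3 one_ne_zero three_ne_zero

theorem hasSum_ex_pent (k : ℕ) [NeZero k] :
    HasSum (fun n => (X : ℤ⟦X⟧) ^ (k * (1 * tri n + 2 * tri (-n)))) (ex k pent) := by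
  simpa [pent] using hasSum_ex_theta_X_pow k 1 2 one_ne_zero two_ne_zero

theorem hasSum_ex_phiNeg (k : ℕ) [NeZero k] :
    HasSum (fun n : ℤ => ((n.negOnePow : ℤ) : ℤ⟦X⟧) * X ^ (k * (1 * tri n + 1 * tri (-n))))
      (ex k phiNeg) := by
  simpa [phiNeg] using hasSum_ex_theta_neg_X_pow k 1 1 one_ne_zero one_ne_zero

theorem hasSum_ex_octo (k : ℕ) [NeZero k] :
    HasSum (fun n : ℤ => ((n.negOnePow : ℤ) : ℤ⟦X⟧) * X ^ (k * (5 * tri n + 1 * tri (-n))))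
      (ex k octo) := by
  simpa [octo] using hasSum_ex_theta_neg_X_pow k 5 1 (by norm_num) one_ne_zero

/-- Equality of two exponents, checked after doubling. -/
theorem exponent_eq {a b c a' b' c' : ℕ} {n n' : ℤ}
    (h : a * (n * (n + 1)) + b * (n * (n - 1)) + 2 * c =
      a' * (n' * (n' + 1)) + b' * (n' * (n' - 1)) + 2 * c') :
    (a * tri n + b * tri (-n)) + c = (a' * tri n' + b' * tri (-n')) + c' := by
  have h1 := two_mul_tri n
  have h2 := two_mul_tri (-n)
  have h3 := two_mul_tri n'
  have h4 := two_mul_tri (-n')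
  zify
  refine mul_left_cancel₀ (two_ne_zero (α := ℤ)) ?_
  linear_combination h + a * h1 + b * h2 - a' * h3 - b' * h4

/-- Even `n` contribute `q^{4k²}`; the classes `1` and `3` modulo 4 each contribute `q ψ(q⁸)`. -/
theorem phi_eq_dissection_two : phi = ex 4 phi + 2 * X * ex 8 psi := by
  have hphi := hasSum_ex_phi 1
  rw [ex_one_apply] at hphi
  have hpsi := (hasSum_ex_psi 8).mul_left X
  refine hphi.unique ?_
  rw [two_mul, add_mul]
  refine hasSum_int_even_odd ((hasSum_ex_phi 4).congr_fun fun k => ?_)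
    (hasSum_int_even_odd ((hasSum_comp_neg hpsi).congr_fun fun k => ?_)
      ((hasSum_comp_add_one hpsi).congr_fun fun k => ?_))
  · congr 1
    have := exponent_eq (a := 1) (b := 1) (c := 0) (a' := 4) (b' := 4) (c' := 0) (n := 2 * k)
      (n' := k) (by push_cast; ring)
    omega
  · rw [← pow_succ']
    congr 1
    have := exponent_eq (a := 1) (b := 1) (c := 0) (a' := 8) (b' := 24) (c' := 1)
      (n := 2 * (2 * k) + 1) (n' := -k) (by push_cast; ring)
    omega
  · rw [← pow_succ']
    congr 1
    have := exponent_eq (a := 1) (b := 1) (c := 0) (a' := 8) (b' := 24) (c' := 1)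
      (n := 2 * (2 * k + 1) + 1) (n' := k + 1) (by push_cast; ring)
    omega

/-- Multiples of 3 give `φ(-q⁹)`; the classes `1` and `2` are exchanged by `n ↦ -n` and give equal
sums. -/
theorem phiNeg_eq_dissection_three : phiNeg = ex 9 phiNeg - 2 * X * ex 3 octo := by
  have hphi := hasSum_ex_phiNeg 1
  rw [ex_one_apply] at hphi
  have hocto := (hasSum_ex_octo 3).mul_left (-X)
  refine hphi.unique ?_
  rw [show ex 9 phiNeg - 2 * X * ex 3 octo = ex 9 phiNeg + -X * ex 3 octo + -X * ex 3 octo by ring]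
  refine hasSum_int_mod_three ((hasSum_ex_phiNeg 9).congr_fun fun k => ?_)
    (hocto.congr_fun fun k => ?_) ((hasSum_comp_neg_add_one hocto).congr_fun fun k => ?_)
  · rw [(Int.negOnePow_eq_iff (3 * k) k).2 ⟨k, by ring⟩]
    congr 2
    have := exponent_eq (a := 1) (b := 1) (c := 0) (a' := 9) (b' := 9) (c' := 0)
      (n := 3 * k) (n' := k) (by push_cast; ring)
    omega
  · rw [(Int.negOnePow_eq_iff (3 * k + 1) (k + 1)).2 ⟨k, by ring⟩, Int.negOnePow_succ]
    have := exponent_eq (a := 1) (b := 1) (c := 0) (a' := 15) (b' := 3) (c' := 1)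
      (n := 3 * k + 1) (n' := k) (by push_cast; ring)
    rw [show 1 * (1 * tri (3 * k + 1) + 1 * tri (-(3 * k + 1))) =
      3 * (5 * tri k + 1 * tri (-k)) + 1 by omega]
    push_cast
    ring
  · rw [Int.negOnePow_neg, (Int.negOnePow_eq_iff (3 * k + 2) (k + 1 + 1)).2 ⟨k, by ring⟩,
      Int.negOnePow_succ (k + 1)]
    have := exponent_eq (a := 1) (b := 1) (c := 0) (a' := 15) (b' := 3) (c' := 1)
      (n := 3 * k + 2) (n' := -(k + 1)) (by push_cast; ring)
    rw [show 1 * (1 * tri (3 * k + 2) + 1 * tri (-(3 * k + 2))) =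
      3 * (5 * tri (-(k + 1)) + 1 * tri (- -(k + 1))) + 1 by omega]
    push_cast
    ring

theorem pent_eq_dissection_two :
    ex 3 pent = theta (X ^ 15) (X ^ 21) + X ^ 3 * theta (X ^ 33) (X ^ 3) := by
  refine (hasSum_ex_pent 3).unique ?_
  refine hasSum_int_even_odd
    ((hasSum_theta_X_pow (a := 15) (b := 21) (by norm_num) (by norm_num)).congr_fun fun k => ?_)
    (((hasSum_theta_X_pow (a := 33) (b := 3) (by norm_num) (by norm_num)).mul_left
      (X ^ 3)).congr_fun fun k => ?_)
  · congr 1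
    have := exponent_eq (a := 3) (b := 6) (c := 0) (a' := 15) (b' := 21) (c' := 0)
      (n := 2 * k) (n' := k) (by push_cast; ring)
    omega
  · rw [← pow_add]
    congr 1
    have := exponent_eq (a := 3) (b := 6) (c := 0) (a' := 33) (b' := 3) (c' := 3)
      (n := 2 * k + 1) (n' := k) (by push_cast; ring)
    omega

/-- The class `n ≡ 1` modulo 3 gives `q ψ(q⁹)`; the classes `0` and `2` give the even and odd halves
of `f(q³, q⁶)`, which is why that series was split first. -/
theorem psi_eq_dissection_three : psi = ex 3 pent + X * ex 9 psi := by
  have hpsi := hasSum_ex_psi 1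
  rw [ex_one_apply] at hpsi
  have h9 := (hasSum_ex_psi 9).mul_left X
  refine hpsi.unique ?_
  rw [pent_eq_dissection_two, add_right_comm]
  refine hasSum_int_mod_three
    ((hasSum_theta_X_pow (a := 15) (b := 21) (by norm_num) (by norm_num)).congr_fun fun k => ?_)
    ((hasSum_comp_neg h9).congr_fun fun k => ?_)
    ((hasSum_comp_neg_add_one ((hasSum_theta_X_pow (a := 33) (b := 3) (by norm_num)
      (by norm_num)).mul_left (X ^ 3))).congr_fun fun k => ?_)
  · congr 1
    have := exponent_eq (a := 1) (b := 3) (c := 0) (a' := 15) (b' := 21) (c' := 0)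
      (n := 3 * k) (n' := k) (by push_cast; ring)
    omega
  · rw [← pow_succ']
    congr 1
    have := exponent_eq (a := 1) (b := 3) (c := 0) (a' := 9) (b' := 27) (c' := 1)
      (n := 3 * k + 1) (n' := -k) (by push_cast; ring)
    omega
  · rw [← pow_add]
    congr 1
    have := exponent_eq (a := 1) (b := 3) (c := 0) (a' := 33) (b' := 3) (c' := 3)
      (n := 3 * k + 2) (n' := -(k + 1)) (by push_cast; ring)
    omega

/-! ### A family of series interpolating between `∑ v₀(n) qⁿ` and a theta series -/

/-- The inverse of `1 - q^m`, for `m > 0`. -/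
noncomputable def oneSubInv (m : ℕ) : ℤ⟦X⟧ := invOfUnit (1 - X ^ m) 1

theorem oneSubInv_mul {m : ℕ} (hm : m ≠ 0) : oneSubInv m * (1 - X ^ m) = 1 :=
  invOfUnit_mul _ _ (by simp [hm])

/-- The summand `q^{n²} ∏_{j < n} (q^{2j+1} + q^{2k}) / (1 - q^{2k+2j+1})`. -/
noncomputable def mockTerm (k n : ℕ) : ℤ⟦X⟧ :=
  X ^ (n ^ 2) * ∏ j ∈ Finset.range n, ((X ^ (2 * j + 1) + X ^ (2 * k)) * oneSubInv (2 * k + 2 * j + 1))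

/-- The series `∑_{n ≥ 0} q^{n²} ∏_{j < n} (q^{2j+1} + q^{2k}) / (1 - q^{2k+2j+1})`. -/
noncomputable def mockSeries (k : ℕ) : ℤ⟦X⟧ := ∑' n, mockTerm k n

theorem X_pow_dvd_mul_of_notMem (d n : ℕ) (f : ℤ⟦X⟧) (hn : n ∉ Finset.range (d + 1)) :
    X ^ (d + 1) ∣ X ^ (n ^ 2) * f := by
  refine (pow_dvd_pow _ ?_).mul_right _
  rw [Finset.mem_range] at hn
  nlinarith

theorem hasSum_mockSeries (k : ℕ) : HasSum (mockTerm k) (mockSeries k) :=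
  hasSum_of_X_pow_dvd (fun d => Finset.range (d + 1))
    fun d n hn => X_pow_dvd_mul_of_notMem d n _ hn

theorem v0Summand_eq_mockTerm (n : ℕ) : v0Summand n = mockTerm 0 n := by
  have hu : IsUnit (qPochhammer X (X ^ 2) n) := isUnit_of_constantCoeff (constantCoeff_qPochhammer_X n)
  refine hu.mul_right_cancel ?_
  rw [v0Summand_mul, mockTerm, qPochhammer, qPochhammer, mul_assoc, ← Finset.prod_mul_distrib]
  congr 1
  refine Finset.prod_congr rfl fun j _ => ?_
  have h := oneSubInv_mul (m := 2 * 0 + 2 * j + 1) (by omega)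
  rw [mul_zero, zero_add] at h ⊢
  rw [pow_zero, ← pow_mul, ← pow_succ', mul_assoc, h]
  ring

theorem mockSeries_zero : mockSeries 0 = PowerSeries.mk v0 := by
  refine (hasSum_mockSeries 0).unique ?_
  convert hasSum_v0 using 1
  funext n
  exact (v0Summand_eq_mockTerm n).symm

/-- The common part of `mockTerm k (n + 1)` and `mockTerm (k + 1) (n + 1)`. -/
noncomputable def mockCore (k n : ℕ) : ℤ⟦X⟧ :=
  X ^ ((n + 1) ^ 2) *
    ∏ j ∈ Finset.range n, ((X ^ (2 * j + 1) + X ^ (2 * k)) * oneSubInv (2 * k + 2 * j + 3))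

theorem mockTerm_succ_mul (k n : ℕ) :
    mockTerm k (n + 1) * (1 - X ^ (2 * k + 1)) = mockCore k n * (X ^ (2 * n + 1) + X ^ (2 * k)) := by
  have h : ∀ n, (∏ j ∈ Finset.range (n + 1), oneSubInv (2 * k + 2 * j + 1)) * (1 - X ^ (2 * k + 1)) =
      ∏ j ∈ Finset.range n, oneSubInv (2 * k + 2 * j + 3) := by
    intro n
    rw [Finset.prod_range_succ', mul_assoc]
    have := oneSubInv_mul (m := 2 * k + 2 * 0 + 1) (by omega)
    rw [mul_zero, add_zero] at this ⊢
    rw [this, mul_one]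
    exact Finset.prod_congr rfl fun j _ => by congr 1
  rw [mockTerm, mockCore, Finset.prod_mul_distrib, Finset.prod_mul_distrib, Finset.prod_range_succ]
  linear_combination (X ^ ((n + 1) ^ 2) * ((∏ j ∈ Finset.range n, (X ^ (2 * j + 1) + X ^ (2 * k))) *
    (X ^ (2 * n + 1) + X ^ (2 * k)))) * h n

theorem mockTerm_succ_succ_mul (k n : ℕ) :
    mockTerm (k + 1) (n + 1) * (1 - X ^ (2 * k + 2 * n + 3)) =
      mockCore k n * (X ^ (2 * n + 1) * (1 + X ^ (2 * k + 1))) := by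
  have h : ∀ n, ∏ j ∈ Finset.range (n + 1), (X ^ (2 * j + 1) + X ^ (2 * (k + 1)) : ℤ⟦X⟧) =
      (X ^ (2 * n + 1) * (1 + X ^ (2 * k + 1))) *
        ∏ j ∈ Finset.range n, (X ^ (2 * j + 1) + X ^ (2 * k)) := by
    intro n
    induction n with
    | zero => simp; ring
    | succ n ih => rw [Finset.prod_range_succ, ih, Finset.prod_range_succ _ n]; ring
  have e : ∀ j, oneSubInv (2 * (k + 1) + 2 * j + 1) = oneSubInv (2 * k + 2 * j + 3) :=
    fun j => by congr 1; ring
  have h3 := oneSubInv_mul (m := 2 * k + 2 * n + 3) (by omega)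
  rw [mockTerm, mockCore, Finset.prod_mul_distrib, h, Finset.prod_mul_distrib]
  simp only [e]
  rw [Finset.prod_range_succ (fun j => oneSubInv _)]
  linear_combination (X ^ ((n + 1) ^ 2) * ((X ^ (2 * n + 1) * (1 + X ^ (2 * k + 1))) *
        ∏ j ∈ Finset.range n, (X ^ (2 * j + 1) + X ^ (2 * k))) *
        ∏ j ∈ Finset.range n, oneSubInv (2 * k + 2 * j + 3)) * h3

theorem mockCore_succ_mul (k n : ℕ) :
    mockCore k (n + 1) * (1 - X ^ (2 * k + 2 * n + 3)) =
      mockCore k n * (X ^ (2 * n + 3) * (X ^ (2 * n + 1) + X ^ (2 * k))) := by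
  have h3 := oneSubInv_mul (m := 2 * k + 2 * n + 3) (by omega)
  rw [mockCore, mockCore, Finset.prod_range_succ]
  linear_combination (X ^ ((n + 1 + 1) ^ 2) * (∏ j ∈ Finset.range n, ((X ^ (2 * j + 1) + X ^ (2 * k)) *
    oneSubInv (2 * k + 2 * j + 3))) * (X ^ (2 * n + 1) + X ^ (2 * k))) * h3

theorem one_sub_X_pow_ne_zero {m : ℕ} (hm : m ≠ 0) : (1 - X ^ m : ℤ⟦X⟧) ≠ 0 := by
  intro h
  have := congrArg constantCoeff h
  simp [hm] at this

/-- Both terms on the left are rational multiples of `mockCore k n`, as is `mockCore k (n + 1)`. The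
weights `1 ∓ q^{4k+2}` are those for which the combination is a difference in `n`. -/
theorem mockTerm_telescope (k n : ℕ) :
    (1 - X ^ (4 * k + 2)) * mockTerm k (n + 1) - (1 + X ^ (4 * k + 2)) * mockTerm (k + 1) (n + 1) =
      (1 + X ^ (2 * k + 1)) * X ^ (2 * k) * (mockCore k n - mockCore k (n + 1)) := by
  have h1 := mockTerm_succ_mul k n
  have h2 := mockTerm_succ_succ_mul k n
  have h3 := mockCore_succ_mul k n
  refine mul_right_cancel₀ (one_sub_X_pow_ne_zero (m := 2 * k + 2 * n + 3) (by omega)) ?_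
  linear_combination (1 + X ^ (2 * k + 1)) * (1 - X ^ (2 * k + 2 * n + 3)) * h1 -
    (1 + X ^ (4 * k + 2)) * h2 + (1 + X ^ (2 * k + 1)) * X ^ (2 * k) * h3

theorem sum_mockTerm_telescope (k N : ℕ) :
    ∑ n ∈ Finset.range (N + 1),
      ((1 - X ^ (4 * k + 2)) * mockTerm k n - (1 + X ^ (4 * k + 2)) * mockTerm (k + 1) n) =
      X ^ (2 * k + 1) * (1 - X ^ (2 * k + 1)) - (1 + X ^ (2 * k + 1)) * X ^ (2 * k) * mockCore k N := by
  induction N with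
  | zero => simp [mockTerm, mockCore]; ring
  | succ N ih => rw [Finset.sum_range_succ, ih, mockTerm_telescope]; ring

theorem mockSeries_recurrence (k : ℕ) :
    (1 - X ^ (4 * k + 2)) * mockSeries k - (1 + X ^ (4 * k + 2)) * mockSeries (k + 1) =
      X ^ (2 * k + 1) * (1 - X ^ (2 * k + 1)) := by
  have h := ((hasSum_mockSeries k).mul_left (1 - X ^ (4 * k + 2))).sub
    ((hasSum_mockSeries (k + 1)).mul_left (1 + X ^ (4 * k + 2)))
  refine tendsto_nhds_unique (h.tendsto_sum_nat.comp (tendsto_add_atTop_nat 1)) ?_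
  -- The boundary term left over carries the factor `X^{(N+1)²}`.
  refine tendsto_of_X_pow_dvd fun d => ⟨d, fun N hN => ?_⟩
  rw [Function.comp_apply, sum_mockTerm_telescope, sub_sub_cancel_left]
  refine (Dvd.dvd.mul_left ?_ _).neg_right
  refine (pow_dvd_pow _ ?_).mul_right _
  nlinarith

/-! ### The bilateral series -/

/-- The bilateral companion of `mockSeries k`. -/
noncomputable def bilateral (k : ℕ) : ℤ⟦X⟧ := mockSeries k + evalNegHom (mockSeries k) - 1

/-- Under `q ↦ -q` the odd part `q^{2k+1}` of the inhomogeneous term cancels, and the `-1` in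
`bilateral` absorbs the remaining `-2 q^{4k+2}`. -/
theorem bilateral_recurrence (k : ℕ) :
    bilateral k * (1 - X ^ (4 * k + 2)) = bilateral (k + 1) * (1 + X ^ (4 * k + 2)) := by
  have h1 := mockSeries_recurrence k
  have h2 := congrArg evalNegHom h1
  simp only [map_sub, map_mul, map_add, map_one, map_pow, evalNegHom_X] at h2
  have e1 : (-X : ℤ⟦X⟧) ^ (4 * k + 2) = X ^ (4 * k + 2) := Even.neg_pow ⟨2 * k + 1, by ring⟩ X
  have e2 : (-X : ℤ⟦X⟧) ^ (2 * k + 1) = -X ^ (2 * k + 1) := Odd.neg_pow ⟨k, by ring⟩ X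
  rw [e1, e2] at h2
  rw [bilateral, bilateral]
  linear_combination h1 + h2

theorem bilateral_zero_mul_prod (N : ℕ) :
    bilateral 0 * ∏ i ∈ Finset.range N, (1 + ((-1 : ℤ) : ℤ⟦X⟧) * X ^ (4 * i + 2)) =
      bilateral N * ∏ i ∈ Finset.range N, (1 + ((1 : ℤ) : ℤ⟦X⟧) * X ^ (4 * i + 2)) := by
  induction N with
  | zero => simp
  | succ N ih =>
    have h := bilateral_recurrence N
    rw [Finset.prod_range_succ, Finset.prod_range_succ]
    push_cast at ih ⊢
    linear_combination (1 - X ^ (4 * N + 2)) * ih +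
      (∏ i ∈ Finset.range N, (1 + 1 * X ^ (4 * i + 2))) * h

/-! ### The limit `k → ∞` and the resulting theta quotient -/

theorem X_pow_dvd_mockTerm_sub (k n : ℕ) : X ^ (2 * k) ∣ mockTerm k n - X ^ (2 * n ^ 2) := by
  have h : ∀ n, X ^ (2 * k) ∣
      (∏ j ∈ Finset.range n, ((X ^ (2 * j + 1) + X ^ (2 * k)) * oneSubInv (2 * k + 2 * j + 1))) -
        (X ^ (n ^ 2) : ℤ⟦X⟧) := by
    intro n
    induction n with
    | zero => simp
    | succ n ih =>
      have h1 := oneSubInv_mul (m := 2 * k + 2 * n + 1) (by omega)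
      have h2 : oneSubInv (2 * k + 2 * n + 1) =
          1 + X ^ (2 * k) * (X ^ (2 * n + 1) * oneSubInv (2 * k + 2 * n + 1)) := by
        linear_combination h1
      rw [Finset.prod_range_succ]
      set u := oneSubInv (2 * k + 2 * n + 1)
      obtain ⟨c, hc⟩ := ih
      refine ⟨c * X ^ (2 * n + 1) * u + (c * X ^ (2 * k) + X ^ (n ^ 2)) * u +
        X ^ (n ^ 2) * X ^ (2 * n + 1) * (X ^ (2 * n + 1) * u), ?_⟩
      linear_combination (X ^ (2 * n + 1) + X ^ (2 * k)) * u * hc +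
        X ^ (n ^ 2) * X ^ (2 * n + 1) * h2
  convert (h n).mul_left (X ^ (n ^ 2)) using 1
  rw [mockTerm]
  ring

/-- The partial theta series `∑_{n ≥ 0} q^{2n²}`. -/
noncomputable def halfTheta : ℤ⟦X⟧ := ∑' n : ℕ, X ^ (2 * n ^ 2)

theorem hasSum_halfTheta : HasSum (fun n : ℕ => (X : ℤ⟦X⟧) ^ (2 * n ^ 2)) halfTheta := by
  refine hasSum_of_X_pow_dvd (fun d => Finset.range (d + 1)) fun d n hn => pow_dvd_pow _ ?_
  rw [Finset.mem_range] at hn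
  nlinarith

theorem X_pow_dvd_mockSeries_sub (k : ℕ) : X ^ (2 * k) ∣ mockSeries k - halfTheta := by
  rw [X_pow_dvd_iff]
  intro m hm
  have h := (hasSum_mockSeries k).sub hasSum_halfTheta
  rw [coeff_eq_sum_of_hasSum h (Finset.range (m + 1))]
  · exact Finset.sum_eq_zero fun n _ => X_pow_dvd_iff.1 (X_pow_dvd_mockTerm_sub k n) m hm
  · intro n hn
    have h2 := X_pow_dvd_mul_of_notMem m n (X ^ (n ^ 2)) hn
    rw [← pow_add, ← two_mul] at h2
    exact (X_pow_dvd_mul_of_notMem m n _ hn).sub h2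

theorem evalNegHom_coeff (f : ℤ⟦X⟧) (n : ℕ) : coeff n (evalNegHom f) = (-1) ^ n * coeff n f :=
  coeff_rescale f (-1) n

theorem ex_two_phi_eq : ex 2 phi = 2 * halfTheta - 1 := by
  have h0 := hasSum_halfTheta
  have h1 : HasSum (fun n : ℕ => (X : ℤ⟦X⟧) ^ (2 * (n + 1) ^ 2)) (halfTheta - 1) := by
    have := (hasSum_nat_add_iff' 1).2 h0
    simpa using this
  refine (hasSum_ex_phi 2).unique ?_
  rw [show 2 * halfTheta - 1 = halfTheta + (halfTheta - 1) by ring]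
  refine HasSum.of_nat_of_neg_add_one (h0.congr_fun fun n => ?_) (h1.congr_fun fun n => ?_)
  · congr 1
    have := tri_add_tri_neg n
    have h2 : tri n + tri (-n) = n ^ 2 := by exact_mod_cast this
    omega
  · congr 1
    have := tri_add_tri_neg (-(n + 1))
    rw [neg_sq] at this
    have h2 : tri (-((n : ℤ) + 1)) + tri (- -((n : ℤ) + 1)) = (n + 1) ^ 2 := by exact_mod_cast this
    omega

theorem evalNegHom_ex_two (f : ℤ⟦X⟧) : evalNegHom (ex 2 f) = ex 2 f := by
  ext n
  rw [evalNegHom_coeff]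
  rcases Nat.even_or_odd n with h | h
  · rw [h.neg_one_pow, one_mul]
  · rw [PowerSeries.coeff_expand_of_not_dvd, mul_zero]
    rwa [← even_iff_two_dvd, Nat.not_even_iff_odd]

/-- Modulo `q^{2k}` both halves of `bilateral k` agree with the even series `halfTheta`, and `2
halfTheta - 1 = φ(q²)`. -/
theorem tendsto_bilateral : Tendsto bilateral atTop (𝓝 (ex 2 phi)) := by
  refine tendsto_of_X_pow_dvd fun d => ⟨d + 1, fun k hk => ?_⟩
  refine (pow_dvd_pow _ (show d + 1 ≤ 2 * k by omega)).trans ?_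
  have h1 := X_pow_dvd_mockSeries_sub k
  have h2 : X ^ (2 * k) ∣ evalNegHom (mockSeries k - halfTheta) := by
    have := map_dvd (evalNegHom (A := ℤ)) h1
    rwa [map_pow, evalNegHom_X, Even.neg_pow ⟨k, by ring⟩] at this
  have h3 : evalNegHom halfTheta = halfTheta := by
    have h := evalNegHom_ex_two phi
    rw [ex_two_phi_eq, map_sub, map_mul, map_one, map_ofNat] at h
    have h2 : (2 : ℤ⟦X⟧) ≠ 0 := fun h2 => by
      have := congrArg constantCoeff h2
      rw [map_ofNat, map_zero] at this
      omega
    refine mul_left_cancel₀ h2 ?_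
    linear_combination h
  rw [map_sub, h3] at h2
  convert h1.add h2 using 1
  rw [bilateral, ex_two_phi_eq]
  ring

theorem bilateral_zero_mul : bilateral 0 * infProd (-1) 4 2 = ex 2 phi * infProd 1 4 2 := by
  refine tendsto_nhds_unique
    ((tendsto_infProd (-1) (by norm_num : 0 < 4) 2).const_mul (bilateral 0)) ?_
  simp only [bilateral_zero_mul_prod]
  exact tendsto_bilateral.mul (tendsto_infProd 1 (by norm_num : 0 < 4) 2)

theorem bilateral_zero_mul_ex_phiNeg : bilateral 0 * ex 4 phiNeg = ex 2 phi ^ 2 := by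
  have h1 := bilateral_zero_mul
  have h2 := infProd_mul_ex_phiNeg
  refine mul_right_cancel₀ (infProd_ne_zero (-1) (a := 4) (b := 2) (by norm_num) (by norm_num)) ?_
  linear_combination ex 4 phiNeg * h1 + ex 2 phi * h2

theorem phiNeg_eq_dissection_two : phiNeg = ex 4 phi - 2 * X * ex 8 psi := by
  have hphi := hasSum_ex_phiNeg 1
  rw [ex_one_apply] at hphi
  have hpsi := (hasSum_ex_psi 8).mul_left (-X)
  refine hphi.unique ?_
  rw [show ex 4 phi - 2 * X * ex 8 psi = ex 4 phi + (-X * ex 8 psi + -X * ex 8 psi) by ring]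
  refine hasSum_int_even_odd ((hasSum_ex_phi 4).congr_fun fun k => ?_)
    (hasSum_int_even_odd ((hasSum_comp_neg hpsi).congr_fun fun k => ?_)
      ((hasSum_comp_add_one hpsi).congr_fun fun k => ?_))
  · rw [Int.negOnePow_two_mul]
    have := exponent_eq (a := 1) (b := 1) (c := 0) (a' := 4) (b' := 4) (c' := 0) (n := 2 * k)
      (n' := k) (by push_cast; ring)
    rw [show 1 * (1 * tri (2 * k) + 1 * tri (-(2 * k))) = 4 * (1 * tri k + 1 * tri (-k)) by omega]
    simp
  · rw [Int.negOnePow_two_mul_add_one]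
    have := exponent_eq (a := 1) (b := 1) (c := 0) (a' := 8) (b' := 24) (c' := 1)
      (n := 2 * (2 * k) + 1) (n' := -k) (by push_cast; ring)
    rw [show 1 * (1 * tri (2 * (2 * k) + 1) + 1 * tri (-(2 * (2 * k) + 1))) =
      8 * (1 * tri (-k) + 3 * tri (- -k)) + 1 by omega]
    push_cast
    ring
  · rw [Int.negOnePow_two_mul_add_one]
    have := exponent_eq (a := 1) (b := 1) (c := 0) (a' := 8) (b' := 24) (c' := 1)
      (n := 2 * (2 * k + 1) + 1) (n' := k + 1) (by push_cast; ring)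
    rw [show 1 * (1 * tri (2 * (2 * k + 1) + 1) + 1 * tri (-(2 * (2 * k + 1) + 1))) =
      8 * (1 * tri (k + 1) + 3 * tri (-(k + 1))) + 1 by omega]
    push_cast
    ring

/-! ### Extraction of an arithmetic progression of coefficients -/

/-- The series `∑ a(m n + r) q^n`, for `f = ∑ a(n) q^n`. -/
noncomputable def sect (m r : ℕ) : ℤ⟦X⟧ →+ ℤ⟦X⟧ where
  toFun f := PowerSeries.mk fun n => coeff (m * n + r) f
  map_add' f g := by ext n; simp
  map_zero' := by ext n; simp

@[simp]
theorem coeff_sect (m r n : ℕ) (f : ℤ⟦X⟧) : coeff n (sect m r f) = coeff (m * n + r) f := by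
  simp [sect]

theorem coeff_X_pow_mul_ex (m : ℕ) [NeZero m] {r s : ℕ} (hr : r < m) (hs : s < m) (h : ℤ⟦X⟧)
    (n : ℕ) : coeff (m * n + r) (X ^ s * ex m h) = if s = r then coeff n h else 0 := by
  rw [coeff_X_pow_mul']
  split_ifs with h1 h2 h2
  · rw [h2, Nat.add_sub_cancel, PowerSeries.coeff_expand_mul]
  · refine PowerSeries.coeff_expand_of_not_dvd _ _ _ ?_
    rintro ⟨c, hc⟩
    refine h2 ?_
    have : m * n + r = m * c + s := by omega
    have h3 := congrArg (· % m) this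
    simpa [Nat.mul_add_mod, Nat.mod_eq_of_lt hr, Nat.mod_eq_of_lt hs, eq_comm] using h3
  · omega
  · rfl

theorem sect_X_pow_mul_ex_self (m : ℕ) [NeZero m] {r : ℕ} (hr : r < m) (h : ℤ⟦X⟧) :
    sect m r (X ^ r * ex m h) = h := by
  ext n
  rw [coeff_sect, coeff_X_pow_mul_ex m hr hr, if_pos rfl]

theorem sect_X_pow_mul_ex_of_ne (m : ℕ) [NeZero m] {r s : ℕ} (hr : r < m) (hs : s < m)
    (hrs : s ≠ r) (h : ℤ⟦X⟧) : sect m r (X ^ s * ex m h) = 0 := by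
  ext n
  rw [coeff_sect, coeff_X_pow_mul_ex m hr hs, if_neg hrs, map_zero]

theorem eq_sum_sect (m : ℕ) [NeZero m] (f : ℤ⟦X⟧) :
    f = ∑ r ∈ Finset.range m, X ^ r * ex m (sect m r f) := by
  ext n
  have hm : 0 < m := NeZero.pos m
  have hn := Nat.mod_lt n hm
  rw [map_sum, Finset.sum_eq_single (n % m)]
  · conv_rhs => rw [← Nat.div_add_mod n m]
    rw [Nat.mul_add_mod, Nat.mod_mod, coeff_X_pow_mul_ex m hn hn, if_pos rfl, coeff_sect,
      Nat.div_add_mod]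
  · intro s hs hsn
    conv_lhs => rw [← Nat.div_add_mod n m]
    rw [coeff_X_pow_mul_ex m hn (Finset.mem_range.1 hs), if_neg hsn]
  · intro h
    exact absurd (Finset.mem_range.2 hn) h

/-- Series in `q^m` act as scalars for the extraction. Hence the strategy below: multiply until the
denominator is a series in `q^m`, then extract. -/
theorem sect_ex_mul (m : ℕ) [NeZero m] {r : ℕ} (hr : r < m) (f g : ℤ⟦X⟧) :
    sect m r (ex m f * g) = f * sect m r g := by
  conv_lhs => rw [eq_sum_sect m g, Finset.mul_sum, map_sum]
  have h : ∀ s, ex m f * (X ^ s * ex m (sect m s g)) = X ^ s * ex m (f * sect m s g) := by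
    intro s
    rw [map_mul]
    ring
  simp only [h]
  rw [Finset.sum_eq_single r, sect_X_pow_mul_ex_self m hr]
  · intro s hs hsr
    exact sect_X_pow_mul_ex_of_ne m hr (Finset.mem_range.1 hs) hsr _
  · intro hr'
    exact absurd (Finset.mem_range.2 hr) hr'

theorem sect_ex (m : ℕ) [NeZero m] (f : ℤ⟦X⟧) : sect m 0 (ex m f) = f := by
  simpa using sect_X_pow_mul_ex_self m (NeZero.pos m) f

theorem ex_injective (m : ℕ) [NeZero m] : Function.Injective (ex m) :=
  Function.LeftInverse.injective (sect_ex m)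

theorem sect_two_zero_eq (a b : ℤ⟦X⟧) : sect 2 0 (ex 2 a + X * ex 2 b) = a := by
  have h := sect_X_pow_mul_ex_of_ne 2 (r := 0) (s := 1) (by norm_num) (by norm_num) (by norm_num) b
  rw [pow_one] at h
  rw [map_add, sect_ex, h, add_zero]

theorem sect_four_one_eq (a b c d : ℤ⟦X⟧) :
    sect 4 1 (ex 4 a + X * ex 4 b + X ^ 2 * ex 4 c + X ^ 3 * ex 4 d) = b := by
  have h0 := sect_X_pow_mul_ex_of_ne 4 (r := 1) (s := 0) (by norm_num) (by norm_num) (by norm_num) a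
  have h1 := sect_X_pow_mul_ex_self 4 (r := 1) (by norm_num) b
  have h2 := sect_X_pow_mul_ex_of_ne 4 (r := 1) (s := 2) (by norm_num) (by norm_num) (by norm_num) c
  have h3 := sect_X_pow_mul_ex_of_ne 4 (r := 1) (s := 3) (by norm_num) (by norm_num) (by norm_num) d
  rw [pow_zero, one_mul] at h0
  rw [pow_one] at h1
  rw [map_add, map_add, map_add, h0, h1, h2, h3]
  ring

theorem sect_three_zero_eq (a b c : ℤ⟦X⟧) :
    sect 3 0 (ex 3 a + X * ex 3 b + X ^ 2 * ex 3 c) = a := by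
  have h1 := sect_X_pow_mul_ex_of_ne 3 (r := 0) (s := 1) (by norm_num) (by norm_num) (by norm_num) b
  have h2 := sect_X_pow_mul_ex_of_ne 3 (r := 0) (s := 2) (by norm_num) (by norm_num) (by norm_num) c
  rw [pow_one] at h1
  rw [map_add, map_add, sect_ex, h1, h2]
  ring

/-! ### Quadratic relations between theta functions -/

/-- After `q ↦ q²` the left side is `φ(q) φ(-q)`, and the 2-dissections of the two factors multiply
to a difference of squares. -/
theorem phiNeg_sq : phiNeg ^ 2 = ex 2 phi ^ 2 - 4 * X * ex 4 psi ^ 2 := by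
  refine ex_injective 2 ?_
  have h1 := phi_mul_phiNeg
  have h2 := phi_eq_dissection_two
  have h3 := phiNeg_eq_dissection_two
  simp only [map_pow, map_sub, map_mul, map_ofNat, PowerSeries.expand_X, ex_ex]
  rw [← h1]
  linear_combination phiNeg * h2 + (ex 4 phi + 2 * X * ex 8 psi) * h3

theorem phi_sq : phi ^ 2 = ex 2 phi ^ 2 + 4 * X * ex 4 psi ^ 2 := by
  have h1 := phiNeg_sq
  have h2 := phi_eq_dissection_two
  have h3 := phiNeg_eq_dissection_two
  have h4 := congrArg (ex 4) psi_sq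
  simp only [map_pow, map_mul, ex_ex] at h4
  linear_combination h1 + (phi + ex 4 phi + 2 * X * ex 8 psi) * h2 -
    (phiNeg + ex 4 phi - 2 * X * ex 8 psi) * h3 - 8 * X * h4

/-- Jacobi's quartic identity: multiply the formulas for `φ(q)² ± φ(-q)²` and use `ψ(q)² = φ(q)
ψ(q²)` at `q²`. -/
theorem phiNeg_pow_four : phiNeg ^ 4 = phi ^ 4 - 16 * X * ex 2 psi ^ 4 := by
  have h1 := phiNeg_sq
  have h2 := phi_sq
  have h4 := congrArg (ex 2) psi_sq
  simp only [map_pow, map_mul, ex_ex] at h4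
  linear_combination (phiNeg ^ 2 + ex 2 phi ^ 2 - 4 * X * ex 4 psi ^ 2) * h1 -
    (phi ^ 2 + ex 2 phi ^ 2 + 4 * X * ex 4 psi ^ 2) * h2 +
    16 * X * (ex 2 psi ^ 2 + ex 2 phi * ex 4 psi) * h4

/-! ### The generating function of `v₀(4 (8 n + 1))` -/

/-- The generating function of `2 v₀(4 n)`, up to its constant term. -/
noncomputable def quarterSeries : ℤ⟦X⟧ := sect 2 0 (sect 2 0 (bilateral 0))

theorem coeff_quarterSeries (n : ℕ) (hn : n ≠ 0) : coeff n quarterSeries = 2 * v0 (4 * n) := by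
  rw [quarterSeries, coeff_sect, coeff_sect, bilateral, mockSeries_zero, map_sub, map_add,
    evalNegHom_coeff, coeff_mk, coeff_one, if_neg (by omega),
    show 2 * (2 * n + 0) + 0 = 4 * n by ring, Even.neg_one_pow ⟨2 * n, by ring⟩]
  ring

theorem phiNeg_mul_quarterSeries : phiNeg * quarterSeries = phi ^ 2 := by
  have h1 : phi ^ 2 = ex 2 phiNeg * sect 2 0 (bilateral 0) := by
    have h := bilateral_zero_mul_ex_phiNeg
    rw [show ex 4 phiNeg = ex 2 (ex 2 phiNeg) from (ex_ex 2 2 phiNeg).symm, mul_comm] at h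
    rw [← sect_ex_mul 2 two_pos, h, ← map_pow, sect_ex]
  have h2 := congrArg (sect 2 0) h1
  rw [sect_ex_mul 2 two_pos] at h2
  rw [quarterSeries, ← h2]
  have h3 : ex 2 phi ^ 2 + 4 * X * ex 4 psi ^ 2 =
      ex 2 (phi ^ 2) + X * ex 2 (4 * ex 2 psi ^ 2) := by
    simp only [map_pow, map_mul, map_ofNat, ex_ex]
    ring
  conv_lhs => rw [phi_sq, h3, sect_two_zero_eq]

theorem phiNeg_pow_four_mul_sect : phiNeg ^ 4 * sect 4 1 quarterSeries =
    6 * phi ^ 4 * ex 2 psi + 32 * X * ex 2 psi ^ 5 := by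
  have h1 := phiNeg_mul_quarterSeries
  have h2 := phi_mul_phiNeg
  have h3 := congrArg (ex 2) h2
  have h4 := congrArg (ex 2) phi_sq
  have h5 := phi_eq_dissection_two
  simp only [map_pow, map_mul, map_add, map_ofNat, PowerSeries.expand_X, ex_ex] at h3 h4
  -- Applying `φ(q) φ(-q) = φ(-q²)²` at `q` and at `q²` turns `φ(q)² / φ(-q)` into `φ(q)³ φ(q²)² /
  -- φ(-q⁴)⁴`, whose denominator is a series in `q⁴`.
  have h6 : ex 4 (phiNeg ^ 4) * quarterSeries = (ex 4 phi + 2 * X * ex 8 psi) ^ 3 *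
      (ex 4 phi ^ 2 + 4 * X ^ 2 * ex 8 psi ^ 2) := by
    rw [← h5, ← h4, map_pow]
    linear_combination phi * ex 2 phi ^ 2 * h1 - quarterSeries * ex 2 phi ^ 2 * h2 -
      quarterSeries * (ex 2 phi * ex 2 phiNeg + ex 4 phiNeg ^ 2) * h3
  have h7 : (ex 4 phi + 2 * X * ex 8 psi) ^ 3 * (ex 4 phi ^ 2 + 4 * X ^ 2 * ex 8 psi ^ 2) =
      ex 4 (phi ^ 5 + 48 * X * phi * ex 2 psi ^ 4) +
      X * ex 4 (6 * phi ^ 4 * ex 2 psi + 32 * X * ex 2 psi ^ 5) +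
      X ^ 2 * ex 4 (12 * phi ^ 3 * ex 2 psi ^ 2 + 4 * phi ^ 3 * ex 2 psi ^ 2) +
      X ^ 3 * ex 4 (8 * phi ^ 2 * ex 2 psi ^ 3 + 24 * phi ^ 2 * ex 2 psi ^ 3) := by
    simp only [map_pow, map_mul, map_add, map_ofNat, PowerSeries.expand_X, ex_ex]
    ring
  have h8 := congrArg (sect 4 1) (h6.trans h7)
  rwa [sect_ex_mul 4 (by norm_num), sect_four_one_eq] at h8

/-- The generating function of `2 v₀(4 (8 n + 1))`. -/
noncomputable def oddSeries : ℤ⟦X⟧ := sect 2 0 (sect 4 1 quarterSeries)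

theorem coeff_oddSeries (n : ℕ) : coeff n oddSeries = 2 * v0 (4 * (8 * n + 1)) := by
  rw [oddSeries, coeff_sect, coeff_sect, coeff_quarterSeries _ (by omega),
    show 4 * (2 * n + 0) + 1 = 8 * n + 1 by ring]

theorem phiNeg_pow_eight_mul_oddSeries :
    phiNeg ^ 8 * oddSeries = psi * (6 * phiNeg ^ 8 + 1024 * X * psi ^ 8) := by
  have h1 := phiNeg_pow_four_mul_sect
  have h2 := phi_mul_phiNeg
  have h3 := phi_sq
  have h4 : ex 2 (phiNeg ^ 8) * sect 4 1 quarterSeries =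
      6 * ex 2 psi * (ex 2 phi ^ 2 + 4 * X * ex 4 psi ^ 2) ^ 4 +
        32 * X * ex 2 psi ^ 5 * (ex 2 phi ^ 2 + 4 * X * ex 4 psi ^ 2) ^ 2 := by
    rw [← h3, show ex 2 (phiNeg ^ 8) = (phi * phiNeg) ^ 4 by rw [h2, map_pow]; ring]
    linear_combination phi ^ 4 * h1
  have h5 : 6 * ex 2 psi * (ex 2 phi ^ 2 + 4 * X * ex 4 psi ^ 2) ^ 4 +
        32 * X * ex 2 psi ^ 5 * (ex 2 phi ^ 2 + 4 * X * ex 4 psi ^ 2) ^ 2 =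
      ex 2 (6 * psi * ((phi ^ 4 + 16 * X * ex 2 psi ^ 4) ^ 2 + 64 * X * phi ^ 4 * ex 2 psi ^ 4) +
        256 * X * psi ^ 5 * phi ^ 2 * ex 2 psi ^ 2) +
      X * ex 2 (96 * psi * (phi ^ 4 + 16 * X * ex 2 psi ^ 4) * phi ^ 2 * ex 2 psi ^ 2 +
        32 * psi ^ 5 * (phi ^ 4 + 16 * X * ex 2 psi ^ 4)) := by
    simp only [map_pow, map_mul, map_add, map_ofNat, PowerSeries.expand_X, ex_ex]
    ring
  have h6 := congrArg (sect 2 0) (h4.trans h5)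
  rw [sect_ex_mul 2 two_pos, sect_two_zero_eq] at h6
  -- With `P = φ(q)⁴` and `S = q ψ(q²)⁴`, `(P + 16S)² + 64PS = (P - 16S)² + 128PS`; since `q ψ⁸ = P
  -- S`, the constant is `6 · 128 + 256 = 1024`.
  rw [oddSeries, h6, show phiNeg ^ 8 = (phiNeg ^ 4) ^ 2 by ring, phiNeg_pow_four,
    show psi ^ 8 = (psi ^ 2) ^ 4 by ring, show psi ^ 5 = psi * (psi ^ 2) ^ 2 by ring, psi_sq]
  ring

theorem constantCoeff_phiNeg : constantCoeff phiNeg = 1 := by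
  rw [phiNeg_eq, map_mul, map_pow, constantCoeff_infProd _ two_pos one_pos,
    constantCoeff_infProd _ two_pos two_pos]
  norm_num

theorem isUnit_phiNeg : IsUnit phiNeg := isUnit_of_constantCoeff constantCoeff_phiNeg

theorem oddSeries_eq : oddSeries = 6 * psi + 1024 * X * (gg ^ 27 * phiNeg) := by
  refine (isUnit_phiNeg.pow 8).mul_left_cancel ?_
  rw [phiNeg_pow_eight_mul_oddSeries, psi_eq_gg_mul]
  ring

/-! ### Reduction modulo `27` -/

theorem ofNat_dvd_of_map_eq_zero (n : ℕ) (f : ℤ⟦X⟧)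
    (h : PowerSeries.map (Int.castRingHom (ZMod n)) f = 0) : (n : ℤ⟦X⟧) ∣ f := by
  have h1 : ∀ m, (n : ℤ) ∣ coeff m f := fun m => by
    have := congrArg (coeff m) h
    rw [coeff_map, map_zero] at this
    exact (ZMod.intCast_zmod_eq_zero_iff_dvd _ n).1 this
  choose c hc using h1
  refine ⟨PowerSeries.mk c, ?_⟩
  ext m
  rw [← map_natCast (C (R := ℤ)) n, coeff_C_mul, coeff_mk]
  exact hc m

/-- Frobenius in characteristic 3, which is trivial on the coefficients `ZMod 3`. -/
theorem three_dvd_cube_sub_ex (f : ℤ⟦X⟧) : (3 : ℤ⟦X⟧) ∣ f ^ 3 - ex 3 f := by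
  have : Fact (Nat.Prime 3) := ⟨Nat.prime_three⟩
  refine ofNat_dvd_of_map_eq_zero 3 _ ?_
  rw [map_sub, map_pow, PowerSeries.map_expand, sub_eq_zero]
  have h := MvPowerSeries.map_frobenius_expand 3 three_ne_zero
    (f := PowerSeries.map (Int.castRingHom (ZMod 3)) f)
  rw [ZMod.frobenius_zmod, MvPowerSeries.map_id] at h
  exact h.symm

theorem sect_ofNat_mul (m : ℕ) [NeZero m] (k : ℕ) (f : ℤ⟦X⟧) :
    sect m 0 ((k : ℤ⟦X⟧) * f) = k * sect m 0 f := by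
  have := sect_ex_mul m (NeZero.pos m) (k : ℤ⟦X⟧) f
  rwa [map_natCast] at this

theorem gg_pow_twentySeven : (27 : ℤ⟦X⟧) ∣ gg ^ 27 - ex 3 (gg ^ 9) := by
  obtain ⟨c, hc⟩ := three_dvd_cube_sub_ex gg
  have h : gg ^ 3 = ex 3 gg + 3 * c := by linear_combination hc
  -- Each cubing gains a factor 3: with `a = g(q³)`, `(a + 3c)³ = a³ + 9A` and `(a³ + 9A)³ = a⁹ +
  -- 27(a⁶A + 9a³A² + 27A³)`.
  refine ⟨(ex 3 gg ^ 2 * c + 3 * ex 3 gg * c ^ 2 + 3 * c ^ 3) * (ex 3 gg ^ 6) +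
    9 * (ex 3 gg ^ 2 * c + 3 * ex 3 gg * c ^ 2 + 3 * c ^ 3) ^ 2 * ex 3 gg ^ 3 +
    27 * (ex 3 gg ^ 2 * c + 3 * ex 3 gg * c ^ 2 + 3 * c ^ 3) ^ 3, ?_⟩
  rw [map_pow, show gg ^ 27 = (gg ^ 3) ^ 9 by ring, h]
  ring

theorem sect_phiNeg : sect 3 0 phiNeg = ex 3 phiNeg := by
  have h : phiNeg = ex 3 (ex 3 phiNeg) + X * ex 3 (-2 * octo) + X ^ 2 * ex 3 0 := by
    conv_lhs => rw [phiNeg_eq_dissection_three]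
    rw [ex_ex, map_mul, map_neg, map_ofNat, map_zero]
    ring
  conv_lhs => rw [h, sect_three_zero_eq]

/-- The denominator in the `3`-dissection of `1 / φ(-q)`. -/
noncomputable def cubicDenom : ℤ⟦X⟧ := ex 3 phiNeg ^ 3 - 8 * X * octo ^ 3

theorem isUnit_cubicDenom : IsUnit cubicDenom := by
  refine isUnit_of_constantCoeff ?_
  rw [cubicDenom, map_sub, map_pow, PowerSeries.constantCoeff_expand, constantCoeff_phiNeg,
    map_mul, map_mul, constantCoeff_X]
  ring

/-- With `a = φ(-q⁹)` and `b = q f(-q¹⁵, -q³)`, the 3-dissections of `ψ` and `φ(-q)` give `g³ =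
g(q³) (a + b) / (a - 2b)`. Multiplying by `a² + 2ab + 4b²` makes the denominator `a³ - 8b³`, a
series in `q³`. -/
theorem ex_gg_dissection :
    gg ^ 3 * ex 3 cubicDenom = ex 3 gg * (ex 9 phiNeg ^ 3 + 4 * X ^ 3 * ex 3 octo ^ 3 +
      3 * (X * (ex 9 phiNeg ^ 2 * ex 3 octo) + X ^ 2 * (2 * (ex 9 phiNeg * ex 3 octo ^ 2)))) := by
  have h1 := phiNeg_eq_dissection_three
  have h2 := psi_eq_dissection_three
  have h3 := congrArg (ex 3) pent_eq_gg_mul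
  have h4 := congrArg (ex 3) gg_mul_octo
  have h5 := psi_eq_gg_mul
  simp only [map_mul, ex_ex] at h3 h4
  have h6 : gg ^ 3 * (ex 9 phiNeg - 2 * X * ex 3 octo) =
      ex 3 gg * (ex 9 phiNeg + X * ex 3 octo) := by
    rw [← h1, ← h5, h2]
    linear_combination h3 - X * h4
  rw [cubicDenom]
  simp only [map_sub, map_pow, map_mul, map_ofNat, PowerSeries.expand_X, ex_ex]
  linear_combination (ex 9 phiNeg ^ 2 + 2 * ex 9 phiNeg * (X * ex 3 octo) +
    4 * (X * ex 3 octo) ^ 2) * h6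

theorem dvd_cubicDenom_mul_sect :
    (27 : ℤ⟦X⟧) ∣ cubicDenom ^ 3 * sect 3 0 (gg ^ 9) -
      gg ^ 3 * (ex 3 phiNeg ^ 3 + 4 * X * octo ^ 3) ^ 3 := by
  have h1 := ex_gg_dissection
  set s : ℤ⟦X⟧ := ex 3 phiNeg ^ 3 + 4 * X * octo ^ 3 with hs
  set r : ℤ⟦X⟧ := X * (ex 9 phiNeg ^ 2 * ex 3 octo) + X ^ 2 * (2 * (ex 9 phiNeg * ex 3 octo ^ 2))
    with hr
  have hs3 : ex 3 s = ex 9 phiNeg ^ 3 + 4 * X ^ 3 * ex 3 octo ^ 3 := by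
    simp only [hs, map_add, map_pow, map_mul, map_ofNat, PowerSeries.expand_X, ex_ex]
  rw [← hs3] at h1
  -- Cube `s(q³) + 3r`: the term `9 s² r` has only exponents prime to 3, so the extraction removes
  -- it, and what remains beyond `s³` is divisible by 27.
  have h2 : ex 3 (cubicDenom ^ 3) * gg ^ 9 =
      (ex 3 (gg ^ 3 * s ^ 3) + X * ex 3 (9 * gg ^ 3 * s ^ 2 * (ex 3 phiNeg ^ 2 * octo)) +
        X ^ 2 * ex 3 (9 * gg ^ 3 * s ^ 2 * (2 * (ex 3 phiNeg * octo ^ 2)))) +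
      ((27 : ℕ) : ℤ⟦X⟧) * (ex 3 gg ^ 3 * (ex 3 s * r ^ 2 + r ^ 3)) := by
    have h3 : ex 3 (cubicDenom ^ 3) * gg ^ 9 = (gg ^ 3 * ex 3 cubicDenom) ^ 3 := by
      rw [map_pow]; ring
    rw [h3, h1]
    simp only [map_pow, map_mul, map_ofNat, ex_ex, hr]
    push_cast
    ring
  have h3 := congrArg (sect 3 0) h2
  rw [sect_ex_mul 3 three_pos, map_add, sect_three_zero_eq, sect_ofNat_mul] at h3
  refine ⟨sect 3 0 (ex 3 gg ^ 3 * (ex 3 s * r ^ 2 + r ^ 3)), ?_⟩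
  push_cast at h3
  linear_combination h3

/-- Proved at `q³`: modulo 3, `φ(-q³) ≡ φ(-q)³ = (a - 2b)³ ≡ a³ - 8b³`, with `a` and `b` as in
`ex_gg_dissection`. -/
theorem three_dvd_cubicDenom_sub : (3 : ℤ⟦X⟧) ∣ cubicDenom - phiNeg := by
  obtain ⟨c, hc⟩ := three_dvd_cube_sub_ex phiNeg
  have h1 : ex 3 cubicDenom - ex 3 phiNeg = ((3 : ℕ) : ℤ⟦X⟧) *
      (c + 2 * X * ex 9 phiNeg ^ 2 * ex 3 octo - 4 * X ^ 2 * ex 9 phiNeg * ex 3 octo ^ 2) := by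
    have h2 := phiNeg_eq_dissection_three
    have h3 : phiNeg ^ 3 = (ex 9 phiNeg - 2 * X * ex 3 octo) ^ 3 := by rw [← h2]
    rw [cubicDenom]
    simp only [map_sub, map_pow, map_mul, map_ofNat, PowerSeries.expand_X, ex_ex]
    push_cast
    linear_combination hc - h3
  have h2 := congrArg (sect 3 0) h1
  rw [← map_sub, sect_ex, sect_ofNat_mul] at h2
  exact ⟨_, by exact_mod_cast h2⟩

theorem phiNeg_mul_sect_congr :
    (27 : ℤ⟦X⟧) ∣ phiNeg * sect 3 0 (gg ^ 9) - (psi + 9 * X * ex 9 psi) := by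
  obtain ⟨c, hc⟩ := dvd_cubicDenom_mul_sect
  obtain ⟨e, he⟩ := three_dvd_cubicDenom_sub
  obtain ⟨k, hk⟩ := three_dvd_cube_sub_ex (ex 3 psi)
  rw [ex_ex] at hk
  have h1 : ex 3 phiNeg ^ 3 + 4 * X * octo ^ 3 = cubicDenom + 12 * X * octo ^ 3 := by
    rw [cubicDenom]; ring
  rw [h1] at hc
  have h2 := psi_eq_gg_mul
  have h3 : gg ^ 3 * octo ^ 3 = ex 3 psi ^ 3 := by rw [← gg_mul_octo]; ring
  refine (isUnit_cubicDenom.pow 3).dvd_mul_left.1 ?_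
  -- Modulo 27, `(T + 12 q o³)³ ≡ T³ + 36 q T² o³` for `o = octo`. Multiplied by `g³ φ(-q)`, this is
  -- `T³ ψ + 36 q T² φ(-q) ψ(q³)³`. The factor 36 allows `φ(-q)` to be replaced by `T` and `ψ(q³)³`
  -- by `ψ(q⁹)`, both known modulo 3.
  set T := cubicDenom
  refine ⟨c * phiNeg + psi * (16 * X ^ 2 * T * octo ^ 6 + 64 * X ^ 3 * octo ^ 9) -
    4 * X * T ^ 2 * e * ex 3 psi ^ 3 + X * T ^ 3 * ex 3 psi ^ 3 + X * T ^ 3 * k, ?_⟩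
  linear_combination phiNeg * hc - (T + 12 * X * octo ^ 3) ^ 3 * h2 +
    36 * X * T ^ 2 * octo ^ 3 * h2 + 36 * X * T ^ 2 * phiNeg * h3 -
    36 * X * T ^ 2 * ex 3 psi ^ 3 * he + 9 * X * T ^ 3 * hk

/-- The coefficients `v₀(36 (8 j + 1))` modulo `27`. -/
theorem v0_congr (j : ℕ) :
    (27 : ℤ) ∣ 2 * v0 (36 * (8 * j + 1)) -
      (1030 * coeff j psi + 9216 * coeff j (X * ex 9 psi)) := by
  obtain ⟨c, hc⟩ := gg_pow_twentySeven
  obtain ⟨e, he⟩ := phiNeg_mul_sect_congr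
  have h1 : gg ^ 27 * phiNeg = ex 3 (gg ^ 9) * phiNeg + ((27 : ℕ) : ℤ⟦X⟧) * (c * phiNeg) := by
    push_cast
    linear_combination phiNeg * hc
  have h2 : sect 3 0 (sect 3 0 (gg ^ 27 * phiNeg)) = psi + 9 * X * ex 9 psi +
      ((27 : ℕ) : ℤ⟦X⟧) * (e + sect 3 0 (sect 3 0 (c * phiNeg))) := by
    rw [h1, map_add, sect_ex_mul 3 three_pos, sect_phiNeg, sect_ofNat_mul, map_add, sect_ofNat_mul,
      mul_comm (gg ^ 9), sect_ex_mul 3 three_pos]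
    push_cast
    linear_combination he
  -- The index is `9j + 1` because the factor `q` in `oddSeries_eq` shifts the exponents `9j`; it
  -- gives `8(9j + 1) + 1 = 9(8j + 1)`.
  have h3 : coeff (9 * j + 1) psi = coeff j psi := by
    conv_lhs => rw [psi_eq_dissection_three]
    rw [map_add, PowerSeries.coeff_expand_of_not_dvd 3 _ _ (by omega), coeff_succ_X_mul,
      PowerSeries.coeff_expand_mul, zero_add]
  have h4 := congrArg (coeff j) h2
  rw [coeff_sect, coeff_sect, show 3 * (3 * j + 0) + 0 = 9 * j by ring] at h4
  have h5 := coeff_oddSeries (9 * j + 1)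
  rw [oddSeries_eq, show (6 : ℤ⟦X⟧) * psi + 1024 * X * (gg ^ 27 * phiNeg) =
    C 6 * psi + X * (C 1024 * (gg ^ 27 * phiNeg)) by rw [map_ofNat, map_ofNat]; ring, map_add,
    coeff_C_mul, coeff_succ_X_mul, coeff_C_mul, h3, h4,
    show psi + 9 * X * ex 9 psi + ((27 : ℕ) : ℤ⟦X⟧) * (e + sect 3 0 (sect 3 0 (c * phiNeg))) =
      psi + C 9 * (X * ex 9 psi) + C 27 * (e + sect 3 0 (sect 3 0 (c * phiNeg))) by
        rw [map_ofNat, map_ofNat]; push_cast; ring, map_add, map_add, coeff_C_mul, coeff_C_mul,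
    show 4 * (8 * (9 * j + 1) + 1) = 36 * (8 * j + 1) by ring] at h5
  exact ⟨1024 * coeff j (e + sect 3 0 (sect 3 0 (c * phiNeg))), by linear_combination -h5⟩

theorem coeff_X_mul_ex_psi_eq_zero {j : ℕ} (hj : j % 9 ≠ 1) : coeff j (X * ex 9 psi) = 0 := by
  cases j with
  | zero => simp
  | succ j =>
    rw [coeff_succ_X_mul]
    exact PowerSeries.coeff_expand_of_not_dvd _ _ _ (by omega)

/-- The exponents of `ψ` are triangular numbers, which are `0` modulo 3 or `1` modulo 9. -/
theorem coeff_psi_eq_zero {j : ℕ} (h3 : j % 3 ≠ 0) (h9 : j % 9 ≠ 1) : coeff j psi = 0 := by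
  rw [psi_eq_dissection_three, map_add, coeff_X_mul_ex_psi_eq_zero h9, add_zero]
  exact PowerSeries.coeff_expand_of_not_dvd _ _ _ (by omega)

theorem v0_modEq_zero {j : ℕ} (h3 : j % 3 ≠ 0) (h9 : j % 9 ≠ 1) :
    v0 (36 * (8 * j + 1)) ≡ 0 [ZMOD 27] := by
  have h := v0_congr j
  rw [coeff_psi_eq_zero h3 h9, coeff_X_mul_ex_psi_eq_zero h9] at h
  rw [Int.modEq_zero_iff_dvd]
  omega

end EighthOrderMock

end

theorem mainTheorem9 (n : ℕ) :
    v0 (3 ^ 2 * (96 * n + 68)) ≡ 0 [ZMOD 27] ∧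
    v0 (3 ^ 3 * (96 * n + 44)) ≡ 0 [ZMOD 27] ∧
    v0 (3 ^ 3 * (96 * n + 76)) ≡ 0 [ZMOD 27] := by
  refine ⟨?_, ?_, ?_⟩
  · rw [show 3 ^ 2 * (96 * n + 68) = 36 * (8 * (3 * n + 2) + 1) by ring]
    exact EighthOrderMock.v0_modEq_zero (by omega) (by omega)
  · rw [show 3 ^ 3 * (96 * n + 44) = 36 * (8 * (9 * n + 4) + 1) by ring]
    exact EighthOrderMock.v0_modEq_zero (by omega) (by omega)
  · rw [show 3 ^ 3 * (96 * n + 76) = 36 * (8 * (9 * n + 7) + 1) by ring]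
    exact EighthOrderMock.v0_modEq_zero (by omega) (by omega)
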